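/- Let $P_1,P_2$ be probability distributions on $[0,\infty)$ and, for integers $n,m\ge 1$, let $G=G_1(n,m,P_1,P_2)$ be the inhomogeneous random intersection graph on the vertex set $\{v_1,\dots,v_n\}$ with attributes $w_1,\dots,w_m$: first draw independent random variables $A_1,\dots,A_n\sim P_1$ and $B_1,\dots,B_m\sim P_2$; then, conditionally on these values, independently for all $i,j$ include the attribute $w_j$ in the set $D_i$ with probability $p_{ij}=\min\{1,A_iB_j(nm)^{-1/2}\}$; two distinct vertices $v_i,v_j$ are adjacent ($v_i\sim v_j$) if and only if $D_i\cap D_j\neq\emptyset$. Let $d(u,v)$ denote the number of common neighbours of the vertices $u,v$. Let $(v_1^*,v_2^*)$ be a uniformly random ordered pair, and $(u_1^*,u_2^*,u_3^*)$ a uniformly random ordered triple, of distinct vertices, each independent of $G$. The clustering function and the clustering coefficient of $G$ are $$cl(r)=\mathbf P\big(v_1^*\sim v_2^*\,\big|\,d(v_1^*,v_2^*)=r\big),\quad r=0,1,2,\dots,\qquad \alpha=\mathbf P\big(u_1^*\sim u_2^*\,\big|\,u_1^*\sim u_3^*,\ u_2^*\sim u_3^*\big).$$ Put $a_k=\mathbf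 E A_1^k$ and $b_k=\mathbf E B_1^k$, and assume $0<\mathbf E A_1^2<\infty$ and $0<\mathbf E B_1^3<\infty$, with $P_1,P_2$ fixed. Let $n\to\infty$ and let $m=m_n$ satisfy $m_n/n\to\beta\in(0,\infty)$. Put $\kappa=a_1a_2^{-1}b_2^{-2}$ and $b_k^*=\mathbf E\big[B_1^k e^{-a_1B_1/\sqrt\beta}\big]$. Then, as $n\to\infty$, $$\alpha=\frac{b_3\kappa}{b_3\kappa+\sqrt\beta}+o(1),$$ $$cl(0)=a_1^2b_2^*\,n^{-1}(1+o(1)),\qquad cl(1)=\frac{b_3^*\kappa}{b_3^*\kappa+\sqrt\beta}\,(1+o(1)),$$ and, for every fixed integer $r\ge2$, $cl(r)=1-o(1)$. -/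

import Mathlib

open MeasureTheory ProbabilityTheory Filter Topology Asymptotics
open scoped NNReal ENNReal

noncomputable section

namespace InhomIntersection

/-- A bipartite incidence pattern between `n` vertices and `m` attributes:
`x (i, j) = true` means that attribute `w_j` belongs to the attribute set `D_i`. -/
abbrev Incidence (n m : ℕ) : Type := Fin n × Fin m → Bool

/-- The attribute set `D_i` of vertex `v_i`. -/
def attrSet {n m : ℕ} (x : Incidence n m) (i : Fin n) : Set (Fin m) := {j | x (i, j) = true}

/-- The intersection graph: two distinct vertices are adjacent iff their attribute sets
intersect. -/
def interGraph {n m : ℕ} (x : Incidence n m) : SimpleGraph (Fin n) where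
  Adj u v := u ≠ v ∧ (attrSet x u ∩ attrSet x v).Nonempty
  symm := ⟨fun _ _ h => ⟨h.1.symm, by rw [Set.inter_comm]; exact h.2⟩⟩
  loopless := ⟨fun _ h => h.1 rfl⟩

/-- `d(u, v)`, the number of common neighbours of `u` and `v`. -/
def codeg {n : ℕ} (G : SimpleGraph (Fin n)) (u v : Fin n) : ℕ := (G.commonNeighbors u v).ncard

/-- `p_{ij} = min {1, A_i B_j / √(n m)}` -/
def linkProb (n m : ℕ) (a b : ℝ≥0) : ℝ≥0 := min 1 (a * b / NNReal.sqrt ((n : ℝ≥0) * (m : ℝ≥0)))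

lemma linkProb_le_one (n m : ℕ) (a b : ℝ≥0) : linkProb n m a b ≤ 1 := min_le_left _ _

/-- The law of the single indicator of `w_j ∈ D_i`, given `A_i = a` and `B_j = b`. -/
def linkLaw (n m : ℕ) (a b : ℝ≥0) : Measure Bool :=
  bernoulliMeasure true false
    (⟨(linkProb n m a b : ℝ), (linkProb n m a b).coe_nonneg,
      NNReal.coe_le_one.2 (linkProb_le_one n m a b)⟩ : unitInterval)

instance (n m : ℕ) (a b : ℝ≥0) : IsProbabilityMeasure (linkLaw n m a b) := by
  unfold linkLaw; infer_instance

/-- The conditional law of the incidence pattern given the weights `A_1, …, A_n` and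
`B_1, …, B_m`: the events `w_j ∈ D_i` are independent with probabilities `p_{ij}`. -/
def condLaw (n m : ℕ) (w : (Fin n → ℝ≥0) × (Fin m → ℝ≥0)) : Measure (Incidence n m) :=
  Measure.pi fun e : Fin n × Fin m => linkLaw n m (w.1 e.1) (w.2 e.2)

instance (n m : ℕ) (w : (Fin n → ℝ≥0) × (Fin m → ℝ≥0)) :
    IsProbabilityMeasure (condLaw n m w) := by
  unfold condLaw; infer_instance

lemma linkLaw_singleton (n m : ℕ) (a b : ℝ≥0) (t : Bool) :
    linkLaw n m a b {t} = if t then (linkProb n m a b : ℝ≥0∞) else 1 - linkProb n m a b := by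
  classical
  unfold linkLaw
  rw [bernoulliMeasure_apply _ (MeasurableSet.singleton _)]
  have h1 := linkProb_le_one n m a b
  cases t
  · simp only [Set.mem_singleton_iff, Bool.true_eq_false, if_true, if_false, Bool.false_eq_true]
    rw [← ENNReal.coe_one, ← ENNReal.coe_sub, ENNReal.coe_inj]
    apply NNReal.eq
    rw [NNReal.coe_sub h1]
    rfl
  · simp only [Set.mem_singleton_iff, if_true, if_false, Bool.false_eq_true]
    rfl

lemma condLaw_singleton (n m : ℕ) (w : (Fin n → ℝ≥0) × (Fin m → ℝ≥0)) (x : Incidence n m) :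
    condLaw n m w {x} = ∏ e : Fin n × Fin m, linkLaw n m (w.1 e.1) (w.2 e.2) {x e} := by
  unfold condLaw
  rw [Measure.pi_singleton]

lemma measurable_condLaw (n m : ℕ) : Measurable (condLaw n m) := by
  refine Measure.measurable_of_measurable_coe _ fun s _ => ?_
  have h : ∀ w, condLaw n m w s = ∑ x ∈ s.toFinite.toFinset, condLaw n m w {x} := by
    intro w
    rw [sum_measure_singleton]
    simp
  simp_rw [h]
  refine Finset.measurable_fun_sum _ fun x _ => ?_
  simp_rw [condLaw_singleton, linkLaw_singleton]
  refine Finset.measurable_fun_prod _ fun e _ => ?_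
  have hp : Measurable fun w : (Fin n → ℝ≥0) × (Fin m → ℝ≥0) =>
      linkProb n m (w.1 e.1) (w.2 e.2) := by
    unfold linkProb; fun_prop
  cases x e
  · simpa using hp.coe_nnreal_ennreal.const_sub 1
  · simpa using hp.coe_nnreal_ennreal

/-- The joint law of the independent weights `A_1, …, A_n ∼ P₁` and `B_1, …, B_m ∼ P₂`. -/
def weightLaw (P₁ P₂ : Measure ℝ≥0) (n m : ℕ) : Measure ((Fin n → ℝ≥0) × (Fin m → ℝ≥0)) :=
  (Measure.pi fun _ => P₁).prod (Measure.pi fun _ => P₂)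

/-- The law of the incidence pattern underlying the inhomogeneous random intersection graph
`G₁(n, m, P₁, P₂)`: first draw the weights, then the incidences given the weights. -/
def incidenceLaw (P₁ P₂ : Measure ℝ≥0) (n m : ℕ) : Measure (Incidence n m) :=
  (weightLaw P₁ P₂ n m).bind (condLaw n m)

instance (P₁ P₂ : Measure ℝ≥0) [IsProbabilityMeasure P₁] [IsProbabilityMeasure P₂] (n m : ℕ) :
    IsProbabilityMeasure (incidenceLaw P₁ P₂ n m) := by
  have : IsProbabilityMeasure (weightLaw P₁ P₂ n m) := by unfold weightLaw; infer_instance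
  constructor
  unfold incidenceLaw
  rw [Measure.bind_apply MeasurableSet.univ (measurable_condLaw n m).aemeasurable]
  simp

/-- The uniform law on ordered pairs of distinct vertices. -/
def pairLaw (n : ℕ) : Measure (Fin n × Fin n) := uniformOn {p | p.1 ≠ p.2}

/-- The uniform law on ordered triples of distinct vertices. -/
def tripleLaw (n : ℕ) : Measure (Fin n × Fin n × Fin n) :=
  uniformOn {t | t.1 ≠ t.2.1 ∧ t.1 ≠ t.2.2 ∧ t.2.1 ≠ t.2.2}

/-- The clustering coefficient `α = P(v₁ ∼ v₂ | v₁ ∼ v₃, v₂ ∼ v₃)`, where `(v₁, v₂, v₃)` is a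
uniformly random triple of distinct vertices, independent of the random graph. -/
def clusteringCoeff (P₁ P₂ : Measure ℝ≥0) (n m : ℕ) : ℝ :=
  (((incidenceLaw P₁ P₂ n m).prod (tripleLaw n))[
    {ω | (interGraph ω.1).Adj ω.2.1 ω.2.2.1} |
    {ω | (interGraph ω.1).Adj ω.2.1 ω.2.2.2 ∧ (interGraph ω.1).Adj ω.2.2.1 ω.2.2.2}]).toReal

/-- The clustering function `cl(r) = P(v₁ ∼ v₂ | d(v₁, v₂) = r)`, where `(v₁, v₂)` is a
uniformly random pair of distinct vertices, independent of the random graph. -/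
def clusteringFun (P₁ P₂ : Measure ℝ≥0) (n m r : ℕ) : ℝ :=
  (((incidenceLaw P₁ P₂ n m).prod (pairLaw n))[
    {ω | (interGraph ω.1).Adj ω.2.1 ω.2.2} |
    {ω | codeg (interGraph ω.1) ω.2.1 ω.2.2 = r}]).toReal

/-- The `k`-th moment of a distribution on `[0, ∞)`. -/
def mom (P : Measure ℝ≥0) (k : ℕ) : ℝ := ∫ x, (x : ℝ) ^ k ∂P

/-- `b*_k = E B^k exp(- a₁ B / √β)` -/
def momStar (P₁ P₂ : Measure ℝ≥0) (β : ℝ) (k : ℕ) : ℝ :=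
  ∫ y, (y : ℝ) ^ k * Real.exp (-(mom P₁ 1 * (y : ℝ) / Real.sqrt β)) ∂P₂

/-- `κ = a₁ a₂⁻¹ b₂⁻²` -/
def kappa (P₁ P₂ : Measure ℝ≥0) : ℝ := mom P₁ 1 * (mom P₁ 2)⁻¹ * (mom P₂ 2 ^ 2)⁻¹

end InhomIntersection

end

noncomputable section

namespace InhomIntersection

/-! Both clustering quantities are ratios `X / (X + Y)`, where `Y` is the probability of the same
configuration with the edge between the two chosen vertices missing. It therefore suffices to find
the order of `X` and of `Y`: `1/n` for pairs (when `r ≥ 1`) and `1/n²` for triples.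

Adjacent vertices typically share exactly one attribute `w_j`, and then their common neighbours are
exactly the other holders of `w_j`. Given `B_j = b`, their number is binomial with `n - 2` trials
and success probability about `a₁ b / √(n m)`, hence asymptotically Poisson with mean `a₁ b / √β`.
Summing over `j` gives `n P(adjacent, d = r) → E[(a₁ B)² Poisson(r)]`, which is `poissonMoment`; the
cases `r = 0, 1` produce `b₂*` and `b₃*` (`tendsto_adjCodeg`).

A common neighbour of non-adjacent vertices is reached through two distinct attributes. Counting
such paths gives the limit `a₁² a₂ b₂²`, for pairs with `d = 1` after scaling by `n` and for open
triples after scaling by `n²` (`tendsto_notAdjCodeg_one`, `tendsto_openPathProb`), while `d ≥ 2` has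
probability `o(1/n)` (`tendsto_notAdjCodeg`). Triangles come mostly from one attribute held by all
three vertices (`tendsto_triangleProb`). For `r = 0` the conditioning event has probability tending
to `1` (`tendsto_codeg_zero`).

All corrections are probabilities of small fixed bipartite patterns. A pattern with `s` incidences
has probability of order `(n m)^{-s/2}`, by dominated convergence, provided vertex degrees are at
most `2` and attribute degrees at most `3`, which is what the moment assumptions allow. Counting
placements then shows that an error vanishes when its incidences outnumber the vertices and
attributes being summed over, together with the scaling power of `n`. The two patterns with a vertex
of degree `3` are handled by `tendsto_scaled_patternProb_union`. -/

instance (P₁ P₂ : Measure ℝ≥0) [IsProbabilityMeasure P₁] [IsProbabilityMeasure P₂] (n m : ℕ) :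
    IsProbabilityMeasure (weightLaw P₁ P₂ n m) := by
  unfold weightLaw; infer_instance

/-! ### Probabilities of finite incidence patterns, and union bounds -/

lemma measurePreserving_comp_injective {ι κ : Type*} [Fintype ι] [Fintype κ]
    (P : Measure ℝ≥0) [IsProbabilityMeasure P] {f : κ → ι} (hf : f.Injective) :
    MeasurePreserving (fun w : ι → ℝ≥0 => fun k => w (f k))
      (Measure.pi fun _ => P) (Measure.pi fun _ => P) := by
  refine ⟨by fun_prop, ?_⟩
  have h : iIndepFun (fun (i : ι) (w : ι → ℝ≥0) => w i) (Measure.pi fun _ : ι => P) :=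
    iIndepFun_pi (X := fun _ x => x) (fun _ => aemeasurable_id)
  have h2 := h.precomp hf
  rw [iIndepFun_iff_map_fun_eq_pi_map (fun i => (measurable_pi_apply _).aemeasurable)] at h2
  rw [h2]
  congr 1
  funext k
  exact (measurePreserving_eval (fun _ : ι => P) (f k)).map_eq

/-- Only the weights of the finitely many placed vertices and attributes matter for a pattern, and
they are again independent with the same laws. This makes pattern probabilities independent of the
placement. -/
lemma measurePreserving_weightLaw (P₁ P₂ : Measure ℝ≥0) [IsProbabilityMeasure P₁]
    [IsProbabilityMeasure P₂] {n m a b : ℕ} {f : Fin a → Fin n} {g : Fin b → Fin m}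
    (hf : f.Injective) (hg : g.Injective) :
    MeasurePreserving
      (fun w : (Fin n → ℝ≥0) × (Fin m → ℝ≥0) => (fun i => w.1 (f i), fun j => w.2 (g j)))
      (weightLaw P₁ P₂ n m) (weightLaw P₁ P₂ a b) :=
  (measurePreserving_comp_injective P₁ hf).prod (measurePreserving_comp_injective P₂ hg)

/-- The probability of the value `t` for one incidence, as a real number. -/
def linkReal (n m : ℕ) (a b : ℝ≥0) (t : Bool) : ℝ :=
  if t then (linkProb n m a b : ℝ) else 1 - linkProb n m a b

lemma measurable_linkProb (n m : ℕ) :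
    Measurable fun q : ℝ≥0 × ℝ≥0 => linkProb n m q.1 q.2 := by
  unfold linkProb; fun_prop

lemma measurable_linkProb_eval (n m : ℕ) {a b : ℕ} (e : Fin a × Fin b) :
    Measurable fun w : (Fin a → ℝ≥0) × (Fin b → ℝ≥0) =>
      (linkProb n m (w.1 e.1) (w.2 e.2) : ℝ) := by
  have h : Measurable fun w : (Fin a → ℝ≥0) × (Fin b → ℝ≥0) => (w.1 e.1, w.2 e.2) := by fun_prop
  exact ((measurable_linkProb n m).comp h).coe_nnreal_real

lemma measurable_linkReal_eval (n m : ℕ) {a b : ℕ} (e : Fin a × Fin b) (t : Bool) :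
    Measurable fun w : (Fin a → ℝ≥0) × (Fin b → ℝ≥0) =>
      linkReal n m (w.1 e.1) (w.2 e.2) t := by
  have := measurable_linkProb_eval n m e
  unfold linkReal
  cases t
  · simp only [Bool.false_eq_true, if_false]; exact this.const_sub 1
  · simp only [if_true]; exact this

lemma linkLaw_real_singleton (n m : ℕ) (a b : ℝ≥0) (t : Bool) :
    (linkLaw n m a b).real {t} = linkReal n m a b t := by
  have h1 := linkProb_le_one n m a b
  rw [measureReal_def, linkLaw_singleton]
  unfold linkReal
  cases t
  · simp only [Bool.false_eq_true, if_false]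
    rw [← ENNReal.coe_one, ← ENNReal.coe_sub, ENNReal.coe_toReal, NNReal.coe_sub h1]
    rfl
  · simp

lemma linkReal_nonneg (n m : ℕ) (a b : ℝ≥0) (t : Bool) : 0 ≤ linkReal n m a b t := by
  rw [← linkLaw_real_singleton]; positivity

lemma linkReal_le_one (n m : ℕ) (a b : ℝ≥0) (t : Bool) : linkReal n m a b t ≤ 1 := by
  rw [← linkLaw_real_singleton]; exact measureReal_le_one

lemma condLaw_real_cylinder {n m : ℕ} (w : (Fin n → ℝ≥0) × (Fin m → ℝ≥0))
    (T : Finset (Fin n × Fin m)) (c : Fin n × Fin m → Bool) :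
    (condLaw n m w).real {x | ∀ e ∈ T, x e = c e} =
      ∏ e ∈ T, linkReal n m (w.1 e.1) (w.2 e.2) (c e) := by
  classical
  have hset : {x : Incidence n m | ∀ e ∈ T, x e = c e} =
      Set.univ.pi fun e => if e ∈ T then {c e} else Set.univ := by
    ext x
    simp only [Set.mem_ofPred_eq, Set.mem_pi, Set.mem_univ, true_imp_iff]
    refine forall_congr' fun e => ?_
    split_ifs with h <;> simp [h]
  rw [hset, measureReal_def, condLaw, Measure.pi_pi, ENNReal.toReal_prod]
  rw [← Finset.prod_subset (Finset.subset_univ T)]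
  · refine Finset.prod_congr rfl fun e he => ?_
    rw [if_pos he, ← linkLaw_real_singleton, measureReal_def]
  · intro e _ he
    rw [if_neg he, measure_univ, ENNReal.toReal_one]

lemma incidenceLaw_real (P₁ P₂ : Measure ℝ≥0) [IsProbabilityMeasure P₁]
    [IsProbabilityMeasure P₂] (n m : ℕ) (s : Set (Incidence n m)) :
    (incidenceLaw P₁ P₂ n m).real s =
      ∫ w, (condLaw n m w).real s ∂weightLaw P₁ P₂ n m := by
  have hs : MeasurableSet s := s.toFinite.measurableSet
  have hm : Measurable fun w => condLaw n m w s :=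
    (Measure.measurable_coe hs).comp (measurable_condLaw n m)
  simp only [measureReal_def]
  rw [integral_toReal hm.aemeasurable (ae_of_all _ fun w => measure_lt_top _ _), incidenceLaw,
    Measure.bind_apply hs (measurable_condLaw n m).aemeasurable]

/-- The probability that the vertices `Fin a` and the attributes `Fin b` show all the incidences
of the pattern `S`. -/
def patternProb (P₁ P₂ : Measure ℝ≥0) (n m : ℕ) {a b : ℕ} (S : Finset (Fin a × Fin b)) : ℝ :=
  ∫ w, ∏ e ∈ S, (linkProb n m (w.1 e.1) (w.2 e.2) : ℝ) ∂weightLaw P₁ P₂ a b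

lemma patternProb_nonneg (P₁ P₂ : Measure ℝ≥0) (n m : ℕ) {a b : ℕ} (S : Finset (Fin a × Fin b)) :
    0 ≤ patternProb P₁ P₂ n m S :=
  integral_nonneg fun _ => Finset.prod_nonneg fun _ _ => NNReal.coe_nonneg _

lemma real_mono {α : Type*} [MeasurableSpace α] {μ : Measure α} [IsFiniteMeasure μ] {s t : Set α}
    (h : s ⊆ t) : μ.real s ≤ μ.real t := measureReal_mono h (measure_ne_top _ _)

section

variable (P₁ P₂ : Measure ℝ≥0) [IsProbabilityMeasure P₁] [IsProbabilityMeasure P₂] {n m a b : ℕ}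

lemma incidenceLaw_real_pattern {f : Fin a → Fin n} {g : Fin b → Fin m}
    (hf : f.Injective) (hg : g.Injective) (S : Finset (Fin a × Fin b)) :
    (incidenceLaw P₁ P₂ n m).real {x | ∀ e ∈ S, x (f e.1, g e.2) = true} =
      patternProb P₁ P₂ n m S := by
  rw [incidenceLaw_real]
  let φ : Fin a × Fin b ↪ Fin n × Fin m := ⟨Prod.map f g, hf.prodMap hg⟩
  have h1 : {x : Incidence n m | ∀ e ∈ S, x (f e.1, g e.2) = true} =
      {x | ∀ e ∈ S.map φ, x e = (fun _ => true) e} := by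
    ext x
    simp only [Set.mem_ofPred_eq, Finset.mem_map]
    exact ⟨fun h e ⟨e', he', hee⟩ => hee ▸ h e' he', fun h e he => h (φ e) ⟨e, he, rfl⟩⟩
  rw [h1]
  simp only [condLaw_real_cylinder, Finset.prod_map]
  have hmp := measurePreserving_weightLaw P₁ P₂ hf hg
  unfold patternProb
  rw [← hmp.map_eq, integral_map hmp.measurable.aemeasurable]
  · rfl
  · refine Measurable.aestronglyMeasurable (Finset.measurable_fun_prod _ fun e _ => ?_)
    exact measurable_linkProb_eval n m e

/-- All the incidences of the pattern `S` are present at a placement of its vertices and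
attributes. -/
def patEvent {n m a b : ℕ} (S : Finset (Fin a × Fin b)) (f : Fin a → Fin n) (g : Fin b → Fin m) :
    Set (Incidence n m) :=
  {x | f.Injective ∧ g.Injective ∧ ∀ e ∈ S, x (f e.1, g e.2) = true}

lemma incidenceLaw_real_patEvent {f : Fin a → Fin n} {g : Fin b → Fin m}
    (hf : f.Injective) (hg : g.Injective) (S : Finset (Fin a × Fin b)) :
    (incidenceLaw P₁ P₂ n m).real (patEvent S f g) = patternProb P₁ P₂ n m S := by
  simp only [patEvent, hf, hg, true_and, incidenceLaw_real_pattern P₁ P₂ hf hg S]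

/-- Injectivity is part of the event, so a degenerate placement has probability zero. Union bounds
can thus run over all tuples of indices. -/
lemma incidenceLaw_real_patEvent_le (S : Finset (Fin a × Fin b)) (f : Fin a → Fin n)
    (g : Fin b → Fin m) :
    (incidenceLaw P₁ P₂ n m).real (patEvent S f g) ≤ patternProb P₁ P₂ n m S := by
  by_cases h : f.Injective ∧ g.Injective
  · exact (incidenceLaw_real_patEvent P₁ P₂ h.1 h.2 S).le
  · have : (patEvent S f g : Set (Incidence n m)) = ∅ := by
      ext x
      simp only [patEvent, Set.mem_ofPred_eq, Set.mem_empty_iff_false, iff_false]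
      exact fun hx => h ⟨hx.1, hx.2.1⟩
    rw [this, measureReal_empty]
    exact patternProb_nonneg ..

lemma real_le_card_mul {α κ : Type*} [MeasurableSpace α] (μ : Measure α) [IsFiniteMeasure μ]
    [Fintype κ] {A : Set α} (E : κ → Set α) (c : ℝ) (hA : ∀ x ∈ A, ∃ t, x ∈ E t)
    (hE : ∀ t, μ.real (E t) ≤ c) : μ.real A ≤ Fintype.card κ * c := by
  have h1 : A ⊆ ⋃ t ∈ (Finset.univ : Finset κ), E t := fun x hx => by simpa using hA x hx
  refine (real_mono h1).trans ((measureReal_biUnion_finset_le _ _).trans ?_)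
  refine (Finset.sum_le_card_nsmul _ _ c fun t _ => hE t).trans ?_
  rw [nsmul_eq_mul, Finset.card_univ]

/-- If the sets `F i \ B i` are disjoint parts of `H`, then `H` has at least the total measure of
the `F i` minus the total measure of the `F i ∩ B i`. -/
lemma sum_sub_sum_le_real {α ι : Type*} [MeasurableSpace α] (μ : Measure α) [IsFiniteMeasure μ]
    [DiscreteMeasurableSpace α] (I : Finset ι) (F B : ι → Set α) (H : Set α)
    (hd : ∀ i ∈ I, ∀ j ∈ I, i ≠ j → ∀ x, x ∈ F i → x ∉ B i → x ∈ F j → x ∉ B j → False)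
    (hs : ∀ i ∈ I, ∀ x, x ∈ F i → x ∉ B i → x ∈ H) :
    ∑ i ∈ I, μ.real (F i) - ∑ i ∈ I, μ.real (F i ∩ B i) ≤ μ.real H := by
  rw [← Finset.sum_sub_distrib]
  have h1 : ∀ i ∈ I, μ.real (F i) - μ.real (F i ∩ B i) = μ.real (F i \ B i) := fun i _ => by
    rw [← measureReal_inter_add_sdiff (μ := μ) (s := F i) (t := B i) (.of_discrete)]; ring
  rw [Finset.sum_congr rfl h1, ← measureReal_biUnion_finset]
  · exact real_mono (Set.iUnion₂_subset fun i hi x hx => hs i hi x hx.1 hx.2)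
  · intro i hi j hj hij
    exact Set.disjoint_left.2 fun x hx hy => hd i hi j hj hij x hx.1 hx.2 hy.1 hy.2
  · exact fun _ _ => .of_discrete

end

/-! ### Asymptotics of the pattern probabilities -/

lemma scaled_linkProb_le (n m : ℕ) (a b : ℝ≥0) :
    Real.sqrt (n * m) * (linkProb n m a b : ℝ) ≤ a * b := by
  -- A vanishing scale is treated apart, since division by it is meaningless.
  rcases (Real.sqrt_nonneg ((n : ℝ) * m)).eq_or_lt with h | h
  · rw [← h, zero_mul]; positivity
  · have : (linkProb n m a b : ℝ) ≤ a * b / Real.sqrt (n * m) := by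
      have : linkProb n m a b ≤ a * b / NNReal.sqrt ((n : ℝ≥0) * (m : ℝ≥0)) := min_le_right _ _
      simpa using NNReal.coe_le_coe.2 this
    rw [le_div_iff₀ h] at this
    linarith

/-- For fixed weights the truncation at `1` is eventually inactive, so the sequence is eventually
constant. -/
lemma tendsto_scaled_linkProb {N M : ℕ → ℕ}
    (h : Tendsto (fun k => Real.sqrt (N k * M k)) atTop atTop) (a b : ℝ≥0) :
    Tendsto (fun k => Real.sqrt (N k * M k) * (linkProb (N k) (M k) a b : ℝ)) atTop
      (𝓝 (a * b)) := by
  refine tendsto_const_nhds.congr' ?_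
  filter_upwards [h.eventually_ge_atTop (a * b + 1)] with k hk
  have hab : (0 : ℝ) ≤ a * b := by positivity
  have hpos : 0 < Real.sqrt (N k * M k) := by linarith
  have : (linkProb (N k) (M k) a b : ℝ) = a * b / Real.sqrt (N k * M k) := by
    simp only [linkProb, NNReal.coe_min, NNReal.coe_one, NNReal.coe_div, NNReal.coe_mul,
      Real.coe_sqrt, NNReal.coe_natCast]
    exact min_eq_right ((div_le_one hpos).2 (by linarith))
  rw [this]
  field_simp

lemma tendsto_linkProb {N M : ℕ → ℕ}
    (h : Tendsto (fun k => Real.sqrt (N k * M k)) atTop atTop) (a b : ℝ≥0) :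
    Tendsto (fun k => (linkProb (N k) (M k) a b : ℝ)) atTop (𝓝 0) := by
  have h1 := (tendsto_scaled_linkProb h a b).mul h.inv_tendsto_atTop
  rw [mul_zero] at h1
  refine h1.congr' ?_
  filter_upwards [h.eventually_gt_atTop 0] with k hk
  simp only [Pi.inv_apply]
  field_simp

/-- The degree of a vertex in a pattern. -/
def vdeg {a b : ℕ} (S : Finset (Fin a × Fin b)) (i : Fin a) : ℕ := (S.filter (·.1 = i)).card

/-- The degree of an attribute in a pattern. -/
def adeg {a b : ℕ} (S : Finset (Fin a × Fin b)) (j : Fin b) : ℕ := (S.filter (·.2 = j)).card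

lemma prod_weights_eq {a b : ℕ} (S : Finset (Fin a × Fin b)) (u : Fin a → ℝ) (v : Fin b → ℝ) :
    ∏ e ∈ S, u e.1 * v e.2 = (∏ i, u i ^ vdeg S i) * ∏ j, v j ^ adeg S j := by
  rw [Finset.prod_mul_distrib]
  congr 1
  · rw [← Finset.prod_fiberwise S (fun e => e.1) (fun e => u e.1)]
    refine Finset.prod_congr rfl fun i _ => ?_
    rw [vdeg, ← Finset.prod_const]
    exact Finset.prod_congr rfl fun e he => by rw [(Finset.mem_filter.1 he).2]
  · rw [← Finset.prod_fiberwise S (fun e => e.2) (fun e => v e.2)]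
    refine Finset.prod_congr rfl fun i _ => ?_
    rw [adeg, ← Finset.prod_const]
    exact Finset.prod_congr rfl fun e he => by rw [(Finset.mem_filter.1 he).2]

lemma integrable_pow_of_le {P : Measure ℝ≥0} [IsProbabilityMeasure P] {k l : ℕ}
    (h : Integrable (fun x : ℝ≥0 => (x : ℝ) ^ l) P) (hkl : k ≤ l) :
    Integrable (fun x : ℝ≥0 => (x : ℝ) ^ k) P := by
  refine ((integrable_const (1 : ℝ)).add h).mono'
    (Measurable.aestronglyMeasurable (by fun_prop)) (ae_of_all _ fun x => ?_)
  have hx : (0 : ℝ) ≤ x := x.coe_nonneg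
  rw [Real.norm_of_nonneg (by positivity)]
  show _ ≤ 1 + (x : ℝ) ^ l
  rcases le_total (x : ℝ) 1 with h1 | h1
  · have := pow_le_one₀ (n := k) hx h1
    have : (0 : ℝ) ≤ (x : ℝ) ^ l := by positivity
    linarith
  · have := pow_le_pow_right₀ h1 hkl
    linarith

section

variable {P₁ P₂ : Measure ℝ≥0} [IsProbabilityMeasure P₁] [IsProbabilityMeasure P₂] {a b : ℕ}

lemma integrable_prod_weights (hA : Integrable (fun x : ℝ≥0 => (x : ℝ) ^ 2) P₁)
    (hB : Integrable (fun y : ℝ≥0 => (y : ℝ) ^ 3) P₂) {S : Finset (Fin a × Fin b)}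
    (hv : ∀ i, vdeg S i ≤ 2) (ha : ∀ j, adeg S j ≤ 3) :
    Integrable (fun w : (Fin a → ℝ≥0) × (Fin b → ℝ≥0) =>
      ∏ e ∈ S, ((w.1 e.1 : ℝ) * (w.2 e.2 : ℝ))) (weightLaw P₁ P₂ a b) := by
  have h : (fun w : (Fin a → ℝ≥0) × (Fin b → ℝ≥0) =>
      ∏ e ∈ S, ((w.1 e.1 : ℝ) * (w.2 e.2 : ℝ))) =
      fun w => (∏ i, (w.1 i : ℝ) ^ vdeg S i) * ∏ j, (w.2 j : ℝ) ^ adeg S j := by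
    funext w
    exact prod_weights_eq S (fun i => (w.1 i : ℝ)) (fun j => (w.2 j : ℝ))
  rw [h]
  exact Integrable.mul_prod
    (Integrable.fintype_prod (f := fun i (x : ℝ≥0) => (x : ℝ) ^ vdeg S i)
      fun i => integrable_pow_of_le hA (hv i))
    (Integrable.fintype_prod (f := fun i (x : ℝ≥0) => (x : ℝ) ^ adeg S i)
      fun j => integrable_pow_of_le hB (ha j))

lemma integral_prod_weights (S : Finset (Fin a × Fin b)) :
    ∫ w, ∏ e ∈ S, ((w.1 e.1 : ℝ) * (w.2 e.2 : ℝ)) ∂weightLaw P₁ P₂ a b =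
      (∏ i, mom P₁ (vdeg S i)) * ∏ j, mom P₂ (adeg S j) := by
  have h : (fun w : (Fin a → ℝ≥0) × (Fin b → ℝ≥0) =>
      ∏ e ∈ S, ((w.1 e.1 : ℝ) * (w.2 e.2 : ℝ))) =
      fun w => (∏ i, (w.1 i : ℝ) ^ vdeg S i) * ∏ j, (w.2 j : ℝ) ^ adeg S j := by
    funext w
    exact prod_weights_eq S (fun i => (w.1 i : ℝ)) (fun j => (w.2 j : ℝ))
  rw [h, weightLaw, integral_prod_mul (fun w : Fin a → ℝ≥0 => ∏ i, (w i : ℝ) ^ vdeg S i)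
    (fun w : Fin b → ℝ≥0 => ∏ i, (w i : ℝ) ^ adeg S i),
    integral_fintype_prod_eq_prod (fun i (x : ℝ≥0) => (x : ℝ) ^ vdeg S i),
    integral_fintype_prod_eq_prod (fun i (x : ℝ≥0) => (x : ℝ) ^ adeg S i)]
  rfl

/-- The incidences in `S` absorb the scale and are dominated by the products of weights; those in
`T` are bounded by `1` and tend to `0` pointwise, so `T` needs no moments. The product of zeros over
`T` is `1` for empty `T` and `0` otherwise, which serves both corollaries. -/
lemma tendsto_scaled_patternProb_aux (hA : Integrable (fun x : ℝ≥0 => (x : ℝ) ^ 2) P₁)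
    (hB : Integrable (fun y : ℝ≥0 => (y : ℝ) ^ 3) P₂) {N M : ℕ → ℕ}
    (h : Tendsto (fun k => Real.sqrt (N k * M k)) atTop atTop)
    {S T : Finset (Fin a × Fin b)} (hST : Disjoint S T)
    (hv : ∀ i, vdeg S i ≤ 2) (ha : ∀ j, adeg S j ≤ 3) :
    Tendsto (fun k => Real.sqrt (N k * M k) ^ S.card * patternProb P₁ P₂ (N k) (M k) (S ∪ T))
      atTop (𝓝 (∫ w, (∏ e ∈ S, ((w.1 e.1 : ℝ) * (w.2 e.2 : ℝ))) * ∏ _e ∈ T, (0 : ℝ)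
        ∂weightLaw P₁ P₂ a b)) := by
  have he : ∀ k, Real.sqrt (N k * M k) ^ S.card * patternProb P₁ P₂ (N k) (M k) (S ∪ T) =
      ∫ w, (∏ e ∈ S, (Real.sqrt (N k * M k) * (linkProb (N k) (M k) (w.1 e.1) (w.2 e.2) : ℝ))) *
        ∏ e ∈ T, (linkProb (N k) (M k) (w.1 e.1) (w.2 e.2) : ℝ) ∂weightLaw P₁ P₂ a b := by
    intro k
    rw [patternProb, ← integral_const_mul]
    congr 1
    funext w
    rw [Finset.prod_union hST, Finset.prod_mul_distrib, Finset.prod_const, mul_assoc]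
  simp_rw [he]
  refine tendsto_integral_of_dominated_convergence _ (fun k => ?_)
    (integrable_prod_weights hA hB hv ha) (fun k => ae_of_all _ fun w => ?_)
    (ae_of_all _ fun w => ?_)
  · have hm := fun e : Fin a × Fin b => measurable_linkProb_eval (N k) (M k) e
    exact ((Finset.measurable_fun_prod _ fun e _ => (hm e).const_mul _).mul
      (Finset.measurable_fun_prod _ fun e _ => hm e)).aestronglyMeasurable
  · have h0 : ∀ e : Fin a × Fin b, (0 : ℝ) ≤ linkProb (N k) (M k) (w.1 e.1) (w.2 e.2) :=
      fun e => NNReal.coe_nonneg _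
    have h1 : 0 ≤ ∏ e ∈ S,
        (Real.sqrt (N k * M k) * (linkProb (N k) (M k) (w.1 e.1) (w.2 e.2) : ℝ)) :=
      Finset.prod_nonneg fun e _ => mul_nonneg (Real.sqrt_nonneg _) (h0 e)
    have h2 : 0 ≤ ∏ e ∈ T, (linkProb (N k) (M k) (w.1 e.1) (w.2 e.2) : ℝ) :=
      Finset.prod_nonneg fun e _ => h0 e
    rw [Real.norm_of_nonneg (mul_nonneg h1 h2)]
    refine (mul_le_of_le_one_right h1 (Finset.prod_le_one (fun e _ => h0 e) fun _ _ => ?_)).trans ?_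
    · exact NNReal.coe_le_one.2 (linkProb_le_one ..)
    · exact Finset.prod_le_prod (fun e _ => mul_nonneg (Real.sqrt_nonneg _) (h0 e))
        fun e _ => scaled_linkProb_le ..
  · exact (tendsto_finsetProd _ fun e _ => tendsto_scaled_linkProb h _ _).mul
      (tendsto_finsetProd _ fun e _ => tendsto_linkProb h _ _)

lemma tendsto_scaled_patternProb (hA : Integrable (fun x : ℝ≥0 => (x : ℝ) ^ 2) P₁)
    (hB : Integrable (fun y : ℝ≥0 => (y : ℝ) ^ 3) P₂) {N M : ℕ → ℕ}
    (h : Tendsto (fun k => Real.sqrt (N k * M k)) atTop atTop)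
    (S : Finset (Fin a × Fin b)) (hv : ∀ i, vdeg S i ≤ 2) (ha : ∀ j, adeg S j ≤ 3) :
    Tendsto (fun k => Real.sqrt (N k * M k) ^ S.card * patternProb P₁ P₂ (N k) (M k) S)
      atTop (𝓝 ((∏ i, mom P₁ (vdeg S i)) * ∏ j, mom P₂ (adeg S j))) := by
  have := tendsto_scaled_patternProb_aux hA hB h (Finset.disjoint_empty_right S) hv ha
  simpa [integral_prod_weights] using this

/-- A pattern with superfluous incidences is less likely than what its other incidences
suggest. -/
lemma tendsto_scaled_patternProb_union (hA : Integrable (fun x : ℝ≥0 => (x : ℝ) ^ 2) P₁)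
    (hB : Integrable (fun y : ℝ≥0 => (y : ℝ) ^ 3) P₂) {N M : ℕ → ℕ}
    (h : Tendsto (fun k => Real.sqrt (N k * M k)) atTop atTop)
    (S T : Finset (Fin a × Fin b)) (hST : Disjoint S T) (hT : T.Nonempty)
    (hv : ∀ i, vdeg S i ≤ 2) (ha : ∀ j, adeg S j ≤ 3) :
    Tendsto (fun k => Real.sqrt (N k * M k) ^ S.card * patternProb P₁ P₂ (N k) (M k) (S ∪ T))
      atTop (𝓝 0) := by
  have := tendsto_scaled_patternProb_aux hA hB h hST hv ha
  have hz : ∏ _e ∈ T, (0 : ℝ) = 0 := by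
    rw [Finset.prod_const, zero_pow (Finset.card_pos.2 hT).ne']
  simpa [hz] using this

end

/-! ### Small patterns

Vertices `0` and `1` are the two given vertices, the others are further vertices. -/

/-- Two vertices with one common attribute. -/
abbrev patEdge : Finset (Fin 2 × Fin 1) := Finset.univ
/-- Two vertices with two common attributes. -/
abbrev patK22 : Finset (Fin 2 × Fin 2) := Finset.univ
/-- Three vertices with one common attribute. -/
abbrev patStar : Finset (Fin 3 × Fin 1) := Finset.univ
/-- Three vertices with two common attributes. -/
abbrev patK32 : Finset (Fin 3 × Fin 2) := Finset.univ
/-- The vertex `2` shares an attribute with `0` and another one with `1`. -/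
abbrev patPath : Finset (Fin 3 × Fin 2) := {(0, 0), (2, 0), (1, 1), (2, 1)}
/-- `patPath`, with the first attribute shared by all vertices. -/
abbrev patPathL : Finset (Fin 3 × Fin 2) := {(0, 0), (2, 0), (1, 1), (2, 1), (1, 0)}
/-- `patPath`, with the second attribute shared by all vertices. -/
abbrev patPathR : Finset (Fin 3 × Fin 2) := {(0, 0), (2, 0), (1, 1), (2, 1), (0, 1)}
/-- A triangle of three distinct attributes. -/
abbrev patTri : Finset (Fin 3 × Fin 3) := {(0, 0), (2, 0), (1, 1), (2, 1), (0, 2), (1, 2)}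
/-- `patPath`, with a second attribute shared by `0` and `2`. -/
abbrev patDoubleL : Finset (Fin 3 × Fin 3) := {(0, 0), (2, 0), (1, 1), (2, 1), (0, 2)} ∪ {(2, 2)}
/-- `patPath`, with a second attribute shared by `1` and `2`. -/
abbrev patDoubleR : Finset (Fin 3 × Fin 3) := {(0, 0), (2, 0), (1, 1), (2, 1), (1, 2)} ∪ {(2, 2)}
/-- Two common neighbours of `0` and `1` with two attributes in total. -/
abbrev patFour2 : Finset (Fin 4 × Fin 2) := {(0, 0), (2, 0), (3, 0), (1, 1), (2, 1), (3, 1)}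
/-- Two common neighbours, one attribute at `0` and two at `1`. -/
abbrev patFourL : Finset (Fin 4 × Fin 3) :=
  {(0, 0), (2, 0), (3, 0), (1, 1), (2, 1), (1, 2), (3, 2)}
/-- Two common neighbours, two attributes at `0` and one at `1`. -/
abbrev patFourR : Finset (Fin 4 × Fin 3) :=
  {(1, 0), (2, 0), (3, 0), (0, 1), (2, 1), (0, 2), (3, 2)}
/-- Two common neighbours with four attributes in total. -/
abbrev patFour4 : Finset (Fin 4 × Fin 4) :=
  {(0, 0), (2, 0), (1, 1), (2, 1), (0, 2), (3, 2), (1, 3), (3, 3)}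

lemma injective_vec2 {α : Type*} {a b : α} (h : a ≠ b) : Function.Injective ![a, b] := by
  intro i j hij
  fin_cases i <;> fin_cases j <;> simp_all

lemma injective_vec3 {α : Type*} {a b c : α} (h1 : a ≠ b) (h2 : a ≠ c) (h3 : b ≠ c) :
    Function.Injective ![a, b, c] := by
  intro i j hij
  fin_cases i <;> fin_cases j <;> simp_all

lemma injective_vec4 {α : Type*} {a b c d : α} (h1 : a ≠ b) (h2 : a ≠ c) (h3 : a ≠ d)
    (h4 : b ≠ c) (h5 : b ≠ d) (h6 : c ≠ d) : Function.Injective ![a, b, c, d] := by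
  intro i j hij
  fin_cases i <;> fin_cases j <;> simp_all

/-! ### Adjacency and common neighbours in terms of attributes -/

section

variable {n m : ℕ} {x : Incidence n m} {u v w : Fin n}

lemma interGraph_adj : (interGraph x).Adj u v ↔
    u ≠ v ∧ ∃ j, x (u, j) = true ∧ x (v, j) = true := Iff.rfl

lemma one_le_codeg_iff : 1 ≤ codeg (interGraph x) u v ↔
    ∃ w, (interGraph x).Adj u w ∧ (interGraph x).Adj v w := by
  rw [codeg, Nat.one_le_iff_ne_zero, ← Nat.pos_iff_ne_zero, Set.ncard_pos (Set.toFinite _)]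
  rfl

lemma two_le_codeg_iff : 2 ≤ codeg (interGraph x) u v ↔
    ∃ w w', w ≠ w' ∧ ((interGraph x).Adj u w ∧ (interGraph x).Adj v w) ∧
      (interGraph x).Adj u w' ∧ (interGraph x).Adj v w' := by
  rw [codeg, Nat.succ_le_iff, Set.one_lt_ncard_iff (Set.toFinite _)]
  constructor
  · rintro ⟨w, w', h1, h2, h3⟩
    exact ⟨w, w', h3, h1, h2⟩
  · rintro ⟨w, w', h3, h1, h2⟩
    exact ⟨w, w', h1, h2, h3⟩

/-- Besides the attribute `j`, another attribute shows that `u` and `v` are adjacent, or two other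
attributes show that they have a common neighbour. -/
def extraEvent (n m : ℕ) (u v : Fin n) (j : Fin m) : Set (Incidence n m) :=
  {x | (∃ k, k ≠ j ∧ x (u, k) = true ∧ x (v, k) = true) ∨
    ∃ w k l, w ≠ u ∧ w ≠ v ∧ k ≠ j ∧ l ≠ j ∧ k ≠ l ∧ x (u, k) = true ∧ x (w, k) = true ∧
      x (v, l) = true ∧ x (w, l) = true}

/-- The attribute `j` is shared by `u`, `v` and exactly `r` further vertices. -/
def columnEvent (n m : ℕ) (u v : Fin n) (j : Fin m) (r : ℕ) : Set (Incidence n m) :=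
  {x | x (u, j) = true ∧ x (v, j) = true ∧
    (Finset.univ.filter fun w => w ≠ u ∧ w ≠ v ∧ x (w, j) = true).card = r}

/-- A common neighbour without `j` meets `u` in some `k ≠ j` and `v` in some `l ≠ j`. Either `k = l`
is a second attribute shared by `u` and `v`, or `k ≠ l` gives a detour; both lie in `extraEvent`. -/
lemma codeg_eq_of_notMem_extraEvent {j : Fin m} (hu : x (u, j) = true)
    (hv : x (v, j) = true) (hx : x ∉ extraEvent n m u v j) :
    codeg (interGraph x) u v =
      (Finset.univ.filter fun w => w ≠ u ∧ w ≠ v ∧ x (w, j) = true).card := by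
  rw [codeg, ← Set.ncard_coe_finset]
  congr 1
  ext w
  simp only [SimpleGraph.mem_commonNeighbors, Finset.coe_filter, Finset.mem_univ, true_and,
    Set.mem_ofPred_eq, interGraph_adj]
  constructor
  · rintro ⟨⟨h1, k, huk, hwk⟩, h2, l, hvl, hwl⟩
    refine ⟨h1.symm, h2.symm, ?_⟩
    by_contra hwj
    have hkj : k ≠ j := by rintro rfl; exact hwj hwk
    have hlj : l ≠ j := by rintro rfl; exact hwj hwl
    by_cases hkl : k = l
    · subst hkl
      exact hx (Or.inl ⟨k, hkj, huk, hvl⟩)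
    · exact hx (Or.inr ⟨w, k, l, h1.symm, h2.symm, hkj, hlj, hkl, huk, hwk, hvl, hwl⟩)
  · rintro ⟨h1, h2, h3⟩
    exact ⟨⟨h1.symm, j, hu, h3⟩, h2.symm, j, hv, h3⟩

end

/-! ### Adjacent pairs with a given number of common neighbours -/

section

variable (P₁ P₂ : Measure ℝ≥0) [IsProbabilityMeasure P₁] [IsProbabilityMeasure P₂] (n m : ℕ)

/-- The error in counting edges by their attributes. -/
def edgeErr : ℝ :=
  (m : ℝ) ^ 2 * patternProb P₁ P₂ n m patK22 + n * (m : ℝ) ^ 3 * patternProb P₁ P₂ n m patTri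

variable {n m}

lemma sum_real_inter_extraEvent_le {u v : Fin n} (huv : u ≠ v) :
    ∑ j, (incidenceLaw P₁ P₂ n m).real
      ({x | x (u, j) = true ∧ x (v, j) = true} ∩ extraEvent n m u v j) ≤ edgeErr P₁ P₂ n m := by
  set μ := incidenceLaw P₁ P₂ n m
  have key : ∀ j, μ.real ({x | x (u, j) = true ∧ x (v, j) = true} ∩ extraEvent n m u v j) ≤
      m * patternProb P₁ P₂ n m patK22 + n * (m : ℝ) ^ 2 * patternProb P₁ P₂ n m patTri := by
    intro j
    let A₁ : Set (Incidence n m) := {x | (x (u, j) = true ∧ x (v, j) = true) ∧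
      ∃ k, k ≠ j ∧ x (u, k) = true ∧ x (v, k) = true}
    let A₂ : Set (Incidence n m) := {x | (x (u, j) = true ∧ x (v, j) = true) ∧
      ∃ w k l, w ≠ u ∧ w ≠ v ∧ k ≠ j ∧ l ≠ j ∧ k ≠ l ∧ x (u, k) = true ∧ x (w, k) = true ∧
      x (v, l) = true ∧ x (w, l) = true}
    have h1 : μ.real A₁ ≤ Fintype.card (Fin m) * patternProb P₁ P₂ n m patK22 := by
      refine real_le_card_mul μ (fun k => patEvent patK22 ![u, v] ![j, k]) _ ?_
        fun _ => incidenceLaw_real_patEvent_le ..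
      rintro x ⟨⟨h1, h2⟩, k, hk, h3, h4⟩
      refine ⟨k, injective_vec2 huv, injective_vec2 hk.symm, ?_⟩
      simp [h1, h2, h3, h4, Fin.forall_fin_two]
    have h2 : μ.real A₂ ≤
        Fintype.card (Fin n × Fin m × Fin m) * patternProb P₁ P₂ n m patTri := by
      refine real_le_card_mul μ
        (fun t => patEvent patTri ![u, v, t.1] ![t.2.1, t.2.2, j]) _ ?_
        fun _ => incidenceLaw_real_patEvent_le ..
      rintro x ⟨⟨h1, h2⟩, w, k, l, hwu, hwv, hkj, hlj, hkl, h3, h4, h5, h6⟩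
      refine ⟨(w, k, l), injective_vec3 huv hwu.symm hwv.symm, injective_vec3 hkl hkj hlj, ?_⟩
      simp [patTri, h1, h2, h3, h4, h5, h6]
    have h3 : {x | x (u, j) = true ∧ x (v, j) = true} ∩ extraEvent n m u v j ⊆ A₁ ∪ A₂ := by
      rintro x ⟨hx, h | h⟩
      · exact Or.inl ⟨hx, h⟩
      · exact Or.inr ⟨hx, h⟩
    refine (real_mono h3).trans ((measureReal_union_le _ _).trans ?_)
    simp only [Fintype.card_prod, Fintype.card_fin, Nat.cast_mul] at h1 h2
    linarith
  refine (Finset.sum_le_card_nsmul _ _ _ fun j _ => key j).trans (le_of_eq ?_)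
  rw [nsmul_eq_mul, Finset.card_univ, Fintype.card_fin, edgeErr]
  ring

lemma real_adj_codeg_le {u v : Fin n} (huv : u ≠ v) (r : ℕ) :
    (incidenceLaw P₁ P₂ n m).real
      {x | (interGraph x).Adj u v ∧ codeg (interGraph x) u v = r} ≤
    ∑ j, (incidenceLaw P₁ P₂ n m).real (columnEvent n m u v j r) + edgeErr P₁ P₂ n m := by
  have h : {x : Incidence n m | (interGraph x).Adj u v ∧ codeg (interGraph x) u v = r} ⊆
      (⋃ j ∈ Finset.univ, columnEvent n m u v j r) ∪
      ⋃ j ∈ Finset.univ, {x | x (u, j) = true ∧ x (v, j) = true} ∩ extraEvent n m u v j := by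
    rintro x ⟨⟨-, j, hu, hv⟩, hr⟩
    by_cases hx : x ∈ extraEvent n m u v j
    · exact Or.inr (Set.mem_biUnion (Finset.mem_coe.2 (Finset.mem_univ j)) ⟨⟨hu, hv⟩, hx⟩)
    · refine Or.inl (Set.mem_biUnion (Finset.mem_coe.2 (Finset.mem_univ j)) ⟨hu, hv, ?_⟩)
      rw [← codeg_eq_of_notMem_extraEvent hu hv hx, hr]
  refine (real_mono h).trans ((measureReal_union_le _ _).trans ?_)
  exact add_le_add (measureReal_biUnion_finset_le _ _)
    ((measureReal_biUnion_finset_le _ _).trans (sum_real_inter_extraEvent_le P₁ P₂ huv))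

/-- Two different shared attributes put the pattern in the `extraEvent` of each of them, so outside
these events the column events are disjoint. -/
lemma le_real_adj_codeg {u v : Fin n} (huv : u ≠ v) (r : ℕ) :
    ∑ j, (incidenceLaw P₁ P₂ n m).real (columnEvent n m u v j r) - edgeErr P₁ P₂ n m ≤
    (incidenceLaw P₁ P₂ n m).real
      {x | (interGraph x).Adj u v ∧ codeg (interGraph x) u v = r} := by
  refine le_trans ?_ (sum_sub_sum_le_real (incidenceLaw P₁ P₂ n m) Finset.univ
    (fun j => columnEvent n m u v j r) (fun j => extraEvent n m u v j) _ ?_ ?_)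
  · refine sub_le_sub_left ((Finset.sum_le_sum fun j _ => ?_).trans
      (sum_real_inter_extraEvent_le P₁ P₂ huv)) _
    exact real_mono (Set.inter_subset_inter_left _ fun x hx => ⟨hx.1, hx.2.1⟩)
  · intro i _ j _ hij x hi hi' hj _
    exact hi' (Or.inl ⟨j, hij.symm, hj.1, hj.2.1⟩)
  · rintro j - x ⟨hu, hv, hr⟩ hx
    exact ⟨⟨huv, j, hu, hv⟩, by rw [codeg_eq_of_notMem_extraEvent hu hv hx, hr]⟩

lemma real_adj_le {u v : Fin n} (huv : u ≠ v) :
    (incidenceLaw P₁ P₂ n m).real {x | (interGraph x).Adj u v} ≤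
      m * patternProb P₁ P₂ n m patEdge := by
  have := real_le_card_mul (incidenceLaw P₁ P₂ n m) (A := {x | (interGraph x).Adj u v})
    (fun j => patEvent patEdge ![u, v] ![j]) _ ?_ fun _ => incidenceLaw_real_patEvent_le ..
  · simpa using this
  · rintro x ⟨-, j, hu, hv⟩
    exact ⟨j, injective_vec2 huv, Function.injective_of_subsingleton _, by
      simp [Fin.forall_fin_two, show x (u, j) = true from hu, show x (v, j) = true from hv]⟩

/-! ### Paths of length two without the third edge -/

/-- `w` is a common neighbour of the non-adjacent vertices `u` and `v`. -/
def openPath (n m : ℕ) (u v w : Fin n) : Set (Incidence n m) :=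
  {x | ¬ (interGraph x).Adj u v ∧ (interGraph x).Adj u w ∧ (interGraph x).Adj v w}

variable (n m) in
/-- The error in counting open paths by their attributes. -/
def pathErr : ℝ :=
  (m : ℝ) ^ 2 * (patternProb P₁ P₂ n m patPathL + patternProb P₁ P₂ n m patPathR) +
  (m : ℝ) ^ 3 * (patternProb P₁ P₂ n m patTri + patternProb P₁ P₂ n m patDoubleL +
    patternProb P₁ P₂ n m patDoubleR)

lemma sum_offDiag_real_patPath {u v w : Fin n} (huv : u ≠ v) (huw : u ≠ w) (hvw : v ≠ w) :
    ∑ t ∈ (Finset.univ : Finset (Fin m)).offDiag,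
      (incidenceLaw P₁ P₂ n m).real (patEvent patPath ![u, v, w] ![t.1, t.2]) =
      m * ((m : ℝ) - 1) * patternProb P₁ P₂ n m patPath := by
  rw [Finset.sum_congr rfl fun t ht => incidenceLaw_real_patEvent P₁ P₂
    (injective_vec3 huv huw hvw) (injective_vec2 (Finset.mem_offDiag.1 ht).2.2) patPath,
    Finset.sum_const, nsmul_eq_mul, Finset.offDiag_card, Finset.card_univ, Fintype.card_fin,
    Nat.cast_sub (Nat.le_mul_self m)]
  push_cast
  ring

lemma mem_patPath {u v w : Fin n} (huv : u ≠ v) (huw : u ≠ w) (hvw : v ≠ w) {j k : Fin m}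
    (hjk : j ≠ k) {x : Incidence n m} : x ∈ patEvent patPath ![u, v, w] ![j, k] ↔
      x (u, j) = true ∧ x (w, j) = true ∧ x (v, k) = true ∧ x (w, k) = true := by
  simp [patEvent, patPath, injective_vec3 huv huw hvw, injective_vec2 hjk]

lemma real_openPath_le {u v w : Fin n} (huv : u ≠ v) (huw : u ≠ w) (hvw : v ≠ w) :
    (incidenceLaw P₁ P₂ n m).real (openPath n m u v w) ≤
      m * ((m : ℝ) - 1) * patternProb P₁ P₂ n m patPath := by
  rw [← sum_offDiag_real_patPath P₁ P₂ huv huw hvw]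
  refine (real_mono ?_).trans (measureReal_biUnion_finset_le _ _)
  rintro x ⟨h, ⟨-, j, hj, hj'⟩, -, k, hk, hk'⟩
  have hjk : j ≠ k := by
    rintro rfl
    exact h ⟨huv, j, hj, hk⟩
  refine Set.mem_biUnion (x := (j, k))
    (Finset.mem_coe.2 (Finset.mem_offDiag.2 ⟨Finset.mem_univ _, Finset.mem_univ _, hjk⟩)) ?_
  exact (mem_patPath huv huw hvw hjk).2 ⟨hj, hj', hk, hk'⟩

/-- Open paths are counted by their witnessing pair of attributes, with the ambiguous or closed ones
removed. -/
lemma le_real_openPath {u v w : Fin n} (huv : u ≠ v) (huw : u ≠ w) (hvw : v ≠ w) :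
    m * ((m : ℝ) - 1) * patternProb P₁ P₂ n m patPath - pathErr P₁ P₂ n m ≤
      (incidenceLaw P₁ P₂ n m).real (openPath n m u v w) := by
  set μ := incidenceLaw P₁ P₂ n m
  rw [← sum_offDiag_real_patPath P₁ P₂ huv huw hvw]
  let f := ![u, v, w]
  have hf : f.Injective := injective_vec3 huv huw hvw
  let F : Fin m × Fin m → Set (Incidence n m) := fun t => patEvent patPath f ![t.1, t.2]
  -- Outside `B`, no attribute is shared by two of the three vertices beyond the path itself. This
  -- makes the witnessing pair unique and also keeps `u` and `v` non-adjacent.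
  let B : Fin m × Fin m → Set (Incidence n m) := fun t =>
    {x | x (v, t.1) = true ∨ x (u, t.2) = true ∨ ∃ l, l ≠ t.1 ∧ l ≠ t.2 ∧
      ((x (u, l) = true ∧ x (v, l) = true) ∨ (x (u, l) = true ∧ x (w, l) = true) ∨
        (x (v, l) = true ∧ x (w, l) = true))}
  have hB : ∀ t ∈ (Finset.univ : Finset (Fin m)).offDiag, μ.real (F t ∩ B t) ≤
      patternProb P₁ P₂ n m patPathL + patternProb P₁ P₂ n m patPathR +
      m * (patternProb P₁ P₂ n m patTri + patternProb P₁ P₂ n m patDoubleL +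
        patternProb P₁ P₂ n m patDoubleR) := by
    rintro ⟨j, k⟩ ht
    have hjk : j ≠ k := (Finset.mem_offDiag.1 ht).2.2
    have h3 : ∀ (S : Finset (Fin 3 × Fin 3)), μ.real (⋃ l, patEvent S f ![j, k, l]) ≤
        m * patternProb P₁ P₂ n m S := by
      intro S
      have := real_le_card_mul μ (A := ⋃ l, patEvent S f ![j, k, l])
        (fun l => patEvent S f ![j, k, l]) _ (fun x hx => Set.mem_iUnion.1 hx)
        fun _ => incidenceLaw_real_patEvent_le ..
      simpa using this
    have hsub : F (j, k) ∩ B (j, k) ⊆ patEvent patPathL f ![j, k] ∪ patEvent patPathR f ![j, k] ∪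
        ((⋃ l, patEvent patTri f ![j, k, l]) ∪ (⋃ l, patEvent patDoubleL f ![j, k, l]) ∪
          ⋃ l, patEvent patDoubleR f ![j, k, l]) := by
      rintro x ⟨hF, hx⟩
      obtain ⟨h1, h2, h3, h4⟩ := (mem_patPath huv huw hvw hjk).1 hF
      rcases hx with hx | hx | ⟨l, hlj, hlk, hx⟩
      · refine Or.inl (Or.inl ⟨hf, injective_vec2 hjk, ?_⟩)
        simp_all [f, patPathL]
      · refine Or.inl (Or.inr ⟨hf, injective_vec2 hjk, ?_⟩)
        simp_all [f, patPathR]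
      · have hl := injective_vec3 hjk hlj.symm hlk.symm
        rcases hx with ⟨h5, h6⟩ | ⟨h5, h6⟩ | ⟨h5, h6⟩
        · refine Or.inr (Or.inl (Or.inl (Set.mem_iUnion.2 ⟨l, hf, hl, ?_⟩)))
          simp [f, patTri, h1, h2, h3, h4, h5, h6]
        · refine Or.inr (Or.inl (Or.inr (Set.mem_iUnion.2 ⟨l, hf, hl, ?_⟩)))
          simp [f, patDoubleL, h1, h2, h3, h4, h5, h6]
        · refine Or.inr (Or.inr (Set.mem_iUnion.2 ⟨l, hf, hl, ?_⟩))
          simp [f, patDoubleR, h1, h2, h3, h4, h5, h6]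
    have hL := incidenceLaw_real_patEvent_le P₁ P₂ patPathL f ![j, k]
    have hR := incidenceLaw_real_patEvent_le P₁ P₂ patPathR f ![j, k]
    refine (real_mono hsub).trans ((measureReal_union_le _ _).trans ?_)
    refine add_le_add ((measureReal_union_le _ _).trans (add_le_add hL hR)) ?_
    rw [mul_add, mul_add]
    exact (measureReal_union_le _ _).trans (add_le_add ((measureReal_union_le _ _).trans
      (add_le_add (h3 _) (h3 _))) (h3 _))
  refine le_trans ?_ (sum_sub_sum_le_real μ (Finset.univ : Finset (Fin m)).offDiag F B _ ?_ ?_)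
  · refine sub_le_sub_left ((Finset.sum_le_card_nsmul _ _ _ hB).trans ?_) _
    rw [nsmul_eq_mul, Finset.offDiag_card, Finset.card_univ, Fintype.card_fin]
    have hm : ((m * m - m : ℕ) : ℝ) ≤ (m : ℝ) ^ 2 := by
      rw [sq]; exact_mod_cast Nat.sub_le _ _
    refine (mul_le_mul_of_nonneg_right hm ?_).trans (le_of_eq (by rw [pathErr]; ring))
    have := fun (b : ℕ) (S : Finset (Fin 3 × Fin b)) => patternProb_nonneg P₁ P₂ n m S
    have h1 := this 2 patPathL
    have h2 := this 2 patPathR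
    have h3 := this 3 patTri
    have h4 := this 3 patDoubleL
    have h5 := this 3 patDoubleR
    positivity
  · rintro ⟨j, k⟩ ht ⟨j', k'⟩ ht' hne x hF hB hF' -
    have hjk : j ≠ k := (Finset.mem_offDiag.1 ht).2.2
    obtain ⟨h1, h2, h3, h4⟩ := (mem_patPath huv huw hvw hjk).1 hF
    obtain ⟨h1', h2', h3', h4'⟩ :=
      (mem_patPath huv huw hvw (Finset.mem_offDiag.1 ht').2.2).1 hF'
    have hj : j' = j := by
      by_contra hj
      by_cases hj2 : j' = k
      · exact hB (Or.inr (Or.inl (hj2 ▸ h1')))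
      · exact hB (Or.inr (Or.inr ⟨j', hj, hj2, Or.inr (Or.inl ⟨h1', h2'⟩)⟩))
    have hk : k' = k := by
      by_contra hk
      by_cases hk2 : k' = j
      · exact hB (Or.inl (hk2 ▸ h3'))
      · exact hB (Or.inr (Or.inr ⟨k', hk2, hk, Or.inr (Or.inr ⟨h3', h4'⟩)⟩))
    exact hne (by rw [hj, hk])
  · rintro ⟨j, k⟩ ht x hF hB
    have hjk : j ≠ k := (Finset.mem_offDiag.1 ht).2.2
    obtain ⟨h1, h2, h3, h4⟩ := (mem_patPath huv huw hvw hjk).1 hF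
    refine ⟨?_, ⟨huw, j, h1, h2⟩, hvw, k, h3, h4⟩
    rintro ⟨-, l, hl, hl'⟩
    by_cases hlj : l = j
    · exact hB (Or.inl (hlj ▸ hl'))
    by_cases hlk : l = k
    · exact hB (Or.inr (Or.inl (hlk ▸ hl)))
    exact hB (Or.inr (Or.inr ⟨l, hlj, hlk, Or.inl ⟨hl, hl'⟩⟩))

/-! ### Triangles -/

variable (n m) in
/-- The error in counting triangles by their common attributes. -/
def triErr : ℝ :=
  (m : ℝ) ^ 2 * patternProb P₁ P₂ n m patK32 + (m : ℝ) ^ 3 * patternProb P₁ P₂ n m patTri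

/-- `u`, `v`, `w` are pairwise adjacent. -/
def triangle (n m : ℕ) (u v w : Fin n) : Set (Incidence n m) :=
  {x | (interGraph x).Adj u v ∧ (interGraph x).Adj u w ∧ (interGraph x).Adj v w}

lemma sum_real_patStar {u v w : Fin n} (huv : u ≠ v) (huw : u ≠ w) (hvw : v ≠ w) :
    ∑ j, (incidenceLaw P₁ P₂ n m).real (patEvent patStar ![u, v, w] ![j]) =
      m * patternProb P₁ P₂ n m patStar := by
  rw [Finset.sum_congr rfl fun j _ => incidenceLaw_real_patEvent P₁ P₂
    (injective_vec3 huv huw hvw) (Function.injective_of_subsingleton ![j]) patStar]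
  simp

lemma mem_patStar {u v w : Fin n} (huv : u ≠ v) (huw : u ≠ w) (hvw : v ≠ w) {j : Fin m}
    {x : Incidence n m} : x ∈ patEvent patStar ![u, v, w] ![j] ↔
      x (u, j) = true ∧ x (v, j) = true ∧ x (w, j) = true := by
  simp [patEvent, injective_vec3 huv huw hvw, Function.injective_of_subsingleton,
    Fin.forall_fin_succ]

/-- If no attribute is held by all three vertices, the attributes witnessing the three edges are
pairwise distinct. -/
lemma real_triangle_le {u v w : Fin n} (huv : u ≠ v) (huw : u ≠ w) (hvw : v ≠ w) :
    (incidenceLaw P₁ P₂ n m).real (triangle n m u v w) ≤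
      m * patternProb P₁ P₂ n m patStar + triErr P₁ P₂ n m := by
  set μ := incidenceLaw P₁ P₂ n m
  have h3 := real_le_card_mul μ (A := ⋃ t : Fin m × Fin m × Fin m,
      patEvent patTri ![u, v, w] ![t.1, t.2.1, t.2.2])
    (fun t : Fin m × Fin m × Fin m => patEvent patTri ![u, v, w] ![t.1, t.2.1, t.2.2]) _
    (fun x hx => Set.mem_iUnion.1 hx)
    fun _ => incidenceLaw_real_patEvent_le P₁ P₂ ..
  have hsub : triangle n m u v w ⊆
      (⋃ j ∈ (Finset.univ : Finset (Fin m)), patEvent patStar ![u, v, w] ![j]) ∪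
      ⋃ t : Fin m × Fin m × Fin m, patEvent patTri ![u, v, w] ![t.1, t.2.1, t.2.2] := by
    rintro x ⟨⟨-, l, hl, hl'⟩, ⟨-, j, hj, hj'⟩, -, k, hk, hk'⟩
    by_cases h : ∃ i, x (u, i) = true ∧ x (v, i) = true ∧ x (w, i) = true
    · obtain ⟨i, hi⟩ := h
      exact Or.inl (Set.mem_biUnion (Finset.mem_coe.2 (Finset.mem_univ i))
        ((mem_patStar huv huw hvw).2 hi))
    · have hjk : j ≠ k := by rintro rfl; exact h ⟨j, hj, hk, hj'⟩
      have hjl : j ≠ l := by rintro rfl; exact h ⟨j, hj, hl', hj'⟩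
      have hkl : k ≠ l := by rintro rfl; exact h ⟨k, hl, hk, hk'⟩
      refine Or.inr (Set.mem_iUnion.2 ⟨(j, k, l), injective_vec3 huv huw hvw,
        injective_vec3 hjk hjl hkl, ?_⟩)
      have e : ∀ {i : Fin n} {j : Fin m}, j ∈ attrSet x i → x (i, j) = true := fun h => h
      simp [patTri, e hl, e hl', e hj, e hj', e hk, e hk']
  refine (real_mono hsub).trans ((measureReal_union_le _ _).trans ?_)
  refine add_le_add ((measureReal_biUnion_finset_le _ _).trans
    (sum_real_patStar P₁ P₂ huv huw hvw).le) (h3.trans ?_)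
  have := patternProb_nonneg P₁ P₂ n m patK32
  simp only [Fintype.card_prod, Fintype.card_fin, Nat.cast_mul, triErr]
  have h4 : 0 ≤ (m : ℝ) ^ 2 * patternProb P₁ P₂ n m patK32 := by positivity
  linarith

lemma le_real_triangle {u v w : Fin n} (huv : u ≠ v) (huw : u ≠ w) (hvw : v ≠ w) :
    m * patternProb P₁ P₂ n m patStar - triErr P₁ P₂ n m ≤
      (incidenceLaw P₁ P₂ n m).real (triangle n m u v w) := by
  set μ := incidenceLaw P₁ P₂ n m
  rw [← sum_real_patStar P₁ P₂ huv huw hvw]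
  let B : Fin m → Set (Incidence n m) := fun j =>
    {x | ∃ k, k ≠ j ∧ x ∈ patEvent patStar ![u, v, w] ![k]}
  have hB : ∀ j ∈ Finset.univ, μ.real (patEvent patStar ![u, v, w] ![j] ∩ B j) ≤
      m * patternProb P₁ P₂ n m patK32 := by
    intro j _
    have := real_le_card_mul μ (A := patEvent patStar ![u, v, w] ![j] ∩ B j)
      (fun k => patEvent patK32 ![u, v, w] ![j, k]) _ ?_
      fun _ => incidenceLaw_real_patEvent_le P₁ P₂ ..
    · simpa using this
    · rintro x ⟨hj, k, hkj, hk⟩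
      obtain ⟨h1, h2, h3⟩ := (mem_patStar huv huw hvw).1 hj
      obtain ⟨h4, h5, h6⟩ := (mem_patStar huv huw hvw).1 hk
      refine ⟨k, injective_vec3 huv huw hvw, injective_vec2 hkj.symm, ?_⟩
      simp [Fin.forall_fin_succ, h1, h2, h3, h4, h5, h6]
  refine le_trans ?_ (sum_sub_sum_le_real μ Finset.univ
    (fun j => patEvent patStar ![u, v, w] ![j]) B _ ?_ ?_)
  · refine sub_le_sub_left ((Finset.sum_le_card_nsmul _ _ _ hB).trans ?_) _
    have h0 := patternProb_nonneg P₁ P₂ n m patTri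
    rw [nsmul_eq_mul, Finset.card_univ, Fintype.card_fin, triErr]
    have h4 : 0 ≤ (m : ℝ) ^ 3 * patternProb P₁ P₂ n m patTri := by positivity
    linarith
  · intro i _ j _ hij x _ hi' hj _
    exact hi' ⟨j, hij.symm, hj⟩
  · rintro j - x hj -
    obtain ⟨h1, h2, h3⟩ := (mem_patStar huv huw hvw).1 hj
    exact ⟨⟨huv, j, h1, h2⟩, ⟨huw, j, h1, h3⟩, hvw, j, h2, h3⟩

/-! ### Common neighbours of non-adjacent vertices -/

variable (n m) in
/-- The bound for the probability that two given vertices are common neighbours of two given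
non-adjacent vertices. -/
def fourErr : ℝ :=
  (m : ℝ) ^ 2 * patternProb P₁ P₂ n m patFour2 +
  (m : ℝ) ^ 3 * (patternProb P₁ P₂ n m patFourL + patternProb P₁ P₂ n m patFourR) +
  (m : ℝ) ^ 4 * patternProb P₁ P₂ n m patFour4

lemma fourErr_nonneg (P₁ P₂ : Measure ℝ≥0) (n m : ℕ) : 0 ≤ fourErr P₁ P₂ n m := by
  have h1 := patternProb_nonneg P₁ P₂ n m patFour2
  have h2 := patternProb_nonneg P₁ P₂ n m patFourL
  have h3 := patternProb_nonneg P₁ P₂ n m patFourR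
  have h4 := patternProb_nonneg P₁ P₂ n m patFour4
  unfold fourErr
  positivity

lemma real_openPath_inter_le {u v w w' : Fin n} (huv : u ≠ v) (hww : w ≠ w') :
    (incidenceLaw P₁ P₂ n m).real (openPath n m u v w ∩ openPath n m u v w') ≤
      fourErr P₁ P₂ n m := by
  set μ := incidenceLaw P₁ P₂ n m
  let f := ![u, v, w, w']
  let E2 := ⋃ t : Fin m × Fin m, patEvent patFour2 f ![t.1, t.2]
  let EL := ⋃ t : Fin m × Fin m × Fin m, patEvent patFourL f ![t.1, t.2.1, t.2.2]
  let ER := ⋃ t : Fin m × Fin m × Fin m, patEvent patFourR f ![t.1, t.2.1, t.2.2]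
  let E4 := ⋃ t : Fin m × Fin m × Fin m × Fin m, patEvent patFour4 f ![t.1, t.2.1, t.2.2.1, t.2.2.2]
  have h2 : μ.real E2 ≤ _ := real_le_card_mul μ _ _ (fun x hx => Set.mem_iUnion.1 hx)
    fun _ => incidenceLaw_real_patEvent_le P₁ P₂ ..
  have hL : μ.real EL ≤ _ := real_le_card_mul μ _ _ (fun x hx => Set.mem_iUnion.1 hx)
    fun _ => incidenceLaw_real_patEvent_le P₁ P₂ ..
  have hR : μ.real ER ≤ _ := real_le_card_mul μ _ _ (fun x hx => Set.mem_iUnion.1 hx)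
    fun _ => incidenceLaw_real_patEvent_le P₁ P₂ ..
  have h4 : μ.real E4 ≤ _ := real_le_card_mul μ _ _ (fun x hx => Set.mem_iUnion.1 hx)
    fun _ => incidenceLaw_real_patEvent_le P₁ P₂ ..
  have hsub : openPath n m u v w ∩ openPath n m u v w' ⊆ E2 ∪ (EL ∪ ER) ∪ E4 := by
    rintro x ⟨⟨hn, ⟨huw, j, hj, hj'⟩, hvw, k, hk, hk'⟩, -, ⟨huw', i, hi, hi'⟩, hvw', l, hl, hl'⟩
    have hf : f.Injective := injective_vec4 huv huw huw' hvw hvw' hww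
    have e : ∀ {i : Fin n} {j : Fin m}, j ∈ attrSet x i → x (i, j) = true := fun h => h
    replace hj := e hj
    replace hj' := e hj'
    replace hk := e hk
    replace hk' := e hk'
    replace hl := e hl
    replace hl' := e hl'
    replace hi := e hi
    replace hi' := e hi'
    -- Since `u` and `v` share nothing, attributes used at `u` differ from those used at `v`. Only
    -- `j = i` and `k = l` remain possible coincidences, hence four patterns.
    have hne : ∀ a b, x (u, a) = true → x (v, b) = true → a ≠ b := by
      rintro a b ha hb rfl
      exact hn ⟨huv, a, ha, hb⟩
    have hjk := hne j k hj hk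
    have hjl := hne j l hj hl
    have hik := hne i k hi hk
    have hil := hne i l hi hl
    by_cases hji : j = i
    · subst hji
      by_cases hkl : k = l
      · subst hkl
        refine Or.inl (Or.inl (Set.mem_iUnion.2 ⟨(j, k), hf, injective_vec2 hjk, ?_⟩))
        simp [f, patFour2, *]
      · refine Or.inl (Or.inr (Or.inl (Set.mem_iUnion.2 ⟨(j, k, l), hf,
          injective_vec3 hjk hjl hkl, ?_⟩)))
        simp [f, patFourL, *]
    · by_cases hkl : k = l
      · subst hkl
        refine Or.inl (Or.inr (Or.inr (Set.mem_iUnion.2 ⟨(k, j, i), hf,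
          injective_vec3 hjk.symm hik.symm hji, ?_⟩)))
        simp [f, patFourR, *]
      · refine Or.inr (Set.mem_iUnion.2 ⟨(j, k, i, l), hf,
          injective_vec4 hjk hji hjl hik.symm hkl hil, ?_⟩)
        simp [f, patFour4, *]
  refine (real_mono hsub).trans ((measureReal_union_le _ _).trans ?_)
  refine (add_le_add ((measureReal_union_le _ _).trans (add_le_add h2
    ((measureReal_union_le _ _).trans (add_le_add hL hR)))) h4).trans (le_of_eq ?_)
  simp only [Fintype.card_prod, Fintype.card_fin, Nat.cast_mul, fourErr]
  ring

lemma real_notAdj_two_le_codeg_le {u v : Fin n} (huv : u ≠ v) :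
    (incidenceLaw P₁ P₂ n m).real {x | ¬ (interGraph x).Adj u v ∧ 2 ≤ codeg (interGraph x) u v} ≤
      (n : ℝ) ^ 2 * fourErr P₁ P₂ n m := by
  set μ := incidenceLaw P₁ P₂ n m
  have := real_le_card_mul μ
    (A := {x | ¬ (interGraph x).Adj u v ∧ 2 ≤ codeg (interGraph x) u v})
    (fun t : Fin n × Fin n =>
      -- The condition `t.1 ≠ t.2` empties the diagonal terms, for which the four-vertex bound is
      -- unavailable.
      {x | t.1 ≠ t.2 ∧ x ∈ openPath n m u v t.1 ∩ openPath n m u v t.2}) (fourErr P₁ P₂ n m) ?_ ?_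
  · simpa [sq] using this
  · rintro x ⟨hn, hx⟩
    obtain ⟨w, w', hww, h1, h2⟩ := two_le_codeg_iff.1 hx
    exact ⟨(w, w'), hww, ⟨hn, h1⟩, hn, h2⟩
  · rintro ⟨w, w'⟩
    by_cases hww : w = w'
    · simpa [hww] using fourErr_nonneg P₁ P₂ n m
    · simpa [hww] using real_openPath_inter_le P₁ P₂ huv hww

lemma card_compl_pair {u v : Fin n} (huv : u ≠ v) :
    ((({u, v}ᶜ : Finset (Fin n)).card : ℕ) : ℝ) = n - 2 := by
  have h2 : ({u, v} : Finset (Fin n)).card = 2 := Finset.card_pair huv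
  have hle : 2 ≤ n := by
    have := Finset.card_le_univ ({u, v} : Finset (Fin n))
    rwa [h2, Fintype.card_fin] at this
  rw [Finset.card_compl, h2, Fintype.card_fin, Nat.cast_sub hle, Nat.cast_two]

lemma notAdj_codeg_eq_iUnion {u v : Fin n} :
    {x : Incidence n m | ¬ (interGraph x).Adj u v ∧ 1 ≤ codeg (interGraph x) u v} =
      ⋃ w ∈ ({u, v}ᶜ : Finset (Fin n)), openPath n m u v w := by
  ext x
  simp only [Set.mem_ofPred_eq, one_le_codeg_iff, Set.mem_iUnion, exists_prop, openPath]
  constructor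
  · rintro ⟨hn, w, h1, h2⟩
    refine ⟨w, ?_, hn, h1, h2⟩
    simp [h1.ne', h2.ne']
  · rintro ⟨w, -, hn, h1, h2⟩
    exact ⟨hn, w, h1, h2⟩

lemma real_notAdj_codeg_le {u v : Fin n} (huv : u ≠ v) :
    (incidenceLaw P₁ P₂ n m).real {x | ¬ (interGraph x).Adj u v ∧ 1 ≤ codeg (interGraph x) u v} ≤
      (n - 2) * (m * ((m : ℝ) - 1) * patternProb P₁ P₂ n m patPath) := by
  rw [notAdj_codeg_eq_iUnion]
  refine (measureReal_biUnion_finset_le _ _).trans ?_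
  refine (Finset.sum_le_card_nsmul _ _ _ fun w hw => ?_).trans
    (le_of_eq (by rw [nsmul_eq_mul, card_compl_pair huv]))
  simp only [Finset.mem_compl, Finset.mem_insert, Finset.mem_singleton, not_or] at hw
  exact real_openPath_le P₁ P₂ huv (Ne.symm hw.1) (Ne.symm hw.2)

/-- A Bonferroni bound over the common neighbour `w`: the overlaps are pairs of open paths, each
controlled by `fourErr`. -/
lemma le_real_notAdj_codeg {u v : Fin n} (huv : u ≠ v) :
    (n - 2) * (m * ((m : ℝ) - 1) * patternProb P₁ P₂ n m patPath - pathErr P₁ P₂ n m) -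
      (n : ℝ) ^ 2 * fourErr P₁ P₂ n m ≤
    (incidenceLaw P₁ P₂ n m).real
      {x | ¬ (interGraph x).Adj u v ∧ 1 ≤ codeg (interGraph x) u v} := by
  set μ := incidenceLaw P₁ P₂ n m
  rw [notAdj_codeg_eq_iUnion]
  let B : Fin n → Set (Incidence n m) := fun w => {x | ∃ w', w' ≠ w ∧ x ∈ openPath n m u v w'}
  have hB : ∀ w ∈ ({u, v}ᶜ : Finset (Fin n)), μ.real (openPath n m u v w ∩ B w) ≤
      n * fourErr P₁ P₂ n m := by
    intro w _
    have := real_le_card_mul μ (A := openPath n m u v w ∩ B w)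
      (fun w' => {x | w ≠ w' ∧ x ∈ openPath n m u v w ∩ openPath n m u v w'})
      (fourErr P₁ P₂ n m) ?_ ?_
    · simpa using this
    · rintro x ⟨hx, w', hw', hx'⟩
      exact ⟨w', hw'.symm, hx, hx'⟩
    · intro w'
      by_cases hww : w = w'
      · simpa [hww] using fourErr_nonneg P₁ P₂ n m
      · simpa [hww] using real_openPath_inter_le P₁ P₂ huv hww
  refine le_trans (sub_le_sub ?_ ?_) (sum_sub_sum_le_real μ ({u, v}ᶜ : Finset (Fin n))
    (fun w => openPath n m u v w) B _ ?_ ?_)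
  · rw [← card_compl_pair huv, ← nsmul_eq_mul]
    refine Finset.card_nsmul_le_sum _ _ _ fun w hw => ?_
    simp only [Finset.mem_compl, Finset.mem_insert, Finset.mem_singleton, not_or] at hw
    exact le_real_openPath P₁ P₂ huv (Ne.symm hw.1) (Ne.symm hw.2)
  · refine (Finset.sum_le_card_nsmul _ _ _ hB).trans ?_
    rw [nsmul_eq_mul, card_compl_pair huv, sq, mul_assoc]
    have := mul_nonneg (Nat.cast_nonneg (α := ℝ) n) (fourErr_nonneg P₁ P₂ n m)
    nlinarith
  · intro i _ j _ hij x _ hi' hj _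
    exact hi' ⟨j, hij.symm, hj⟩
  · intro w hw x hx _
    exact Set.mem_biUnion hw hx

end

/-! ### The number of vertices with a given attribute -/

/-- The probability that a vertex has a given attribute of weight `b`. -/
def meanLink (P₁ : Measure ℝ≥0) (n m : ℕ) (b : ℝ≥0) : ℝ := ∫ a, (linkProb n m a b : ℝ) ∂P₁

/-- The probability that two given vertices have a given attribute, together with exactly `r`
further vertices. -/
def columnProb (P₁ P₂ : Measure ℝ≥0) (n m r : ℕ) : ℝ :=
  ∫ b, (n - 2).choose r * (meanLink P₁ n m b ^ (r + 2) * (1 - meanLink P₁ n m b) ^ (n - 2 - r)) ∂P₂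

section

variable (P₁ P₂ : Measure ℝ≥0) [IsProbabilityMeasure P₁] [IsProbabilityMeasure P₂] {n m : ℕ}

lemma integrable_linkProb (n m : ℕ) (b : ℝ≥0) :
    Integrable (fun a => (linkProb n m a b : ℝ)) P₁ := by
  have h : Measurable fun a : ℝ≥0 => (a, b) := by fun_prop
  refine (integrable_const (1 : ℝ)).mono'
    ((measurable_linkProb n m).comp h).coe_nnreal_real.aestronglyMeasurable
    (ae_of_all _ fun a => ?_)
  rw [Real.norm_of_nonneg (NNReal.coe_nonneg _)]
  exact NNReal.coe_le_one.2 (linkProb_le_one ..)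

lemma meanLink_nonneg (P₁ : Measure ℝ≥0) (n m : ℕ) (b : ℝ≥0) : 0 ≤ meanLink P₁ n m b :=
  integral_nonneg fun _ => NNReal.coe_nonneg _

lemma meanLink_le_one (n m : ℕ) (b : ℝ≥0) : meanLink P₁ n m b ≤ 1 := by
  have := integral_mono (integrable_linkProb P₁ n m b) (integrable_const (1 : ℝ))
    fun a => NNReal.coe_le_one.2 (linkProb_le_one n m a b)
  simpa [meanLink] using this

lemma measurable_meanLink (n m : ℕ) : Measurable (meanLink P₁ n m) := by
  have h : StronglyMeasurable fun q : ℝ≥0 × ℝ≥0 => (linkProb n m q.2 q.1 : ℝ) :=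
    ((measurable_linkProb n m).comp measurable_swap).coe_nnreal_real.stronglyMeasurable
  exact (h.integral_prod_right (ν := P₁)).measurable

lemma integral_linkReal (b : ℝ≥0) (t : Bool) :
    ∫ a, linkReal n m a b t ∂P₁ = if t then meanLink P₁ n m b else 1 - meanLink P₁ n m b := by
  cases t
  · simp only [linkReal, Bool.false_eq_true, if_false]
    rw [integral_sub (integrable_const _) (integrable_linkProb P₁ n m b)]
    simp [meanLink]
  · simp [linkReal, meanLink]

/-- Within one column each `A_i` occurs only once. Given `B_j`, integrating out the vertex weights
therefore leaves independent trials with the common success probability `meanLink`. -/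
lemma incidenceLaw_real_column (j : Fin m) (c : Fin n → Bool) :
    (incidenceLaw P₁ P₂ n m).real {x | ∀ i, x (i, j) = c i} =
      ∫ b, ∏ i, (if c i then meanLink P₁ n m b else 1 - meanLink P₁ n m b) ∂P₂ := by
  let φ : Fin n ↪ Fin n × Fin m := ⟨fun i => (i, j), fun a b h => (Prod.ext_iff.1 h).1⟩
  have h1 : {x : Incidence n m | ∀ i, x (i, j) = c i} =
      {x | ∀ e ∈ Finset.univ.map φ, x e = (fun e : Fin n × Fin m => c e.1) e} := by
    ext x
    simp only [Set.mem_ofPred_eq, Finset.mem_map, Finset.mem_univ, true_and]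
    exact ⟨fun h e ⟨i, hi⟩ => hi ▸ h i, fun h i => h (φ i) ⟨i, rfl⟩⟩
  rw [h1, incidenceLaw_real]
  simp only [condLaw_real_cylinder, Finset.prod_map]
  have hm : ∀ (i : Fin n), Measurable fun w : (Fin n → ℝ≥0) × (Fin m → ℝ≥0) =>
      linkReal n m (w.1 i) (w.2 j) (c i) := fun i => measurable_linkReal_eval n m (i, j) (c i)
  have hint : Integrable (fun w : (Fin n → ℝ≥0) × (Fin m → ℝ≥0) =>
      ∏ i, linkReal n m (w.1 i) (w.2 j) (c i)) (weightLaw P₁ P₂ n m) := by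
    have hprod : Measurable fun w : (Fin n → ℝ≥0) × (Fin m → ℝ≥0) =>
        ∏ i, linkReal n m (w.1 i) (w.2 j) (c i) := Finset.measurable_fun_prod _ fun i _ => hm i
    refine (integrable_const (1 : ℝ)).mono' hprod.aestronglyMeasurable (ae_of_all _ fun w => ?_)
    rw [Real.norm_of_nonneg (Finset.prod_nonneg fun _ _ => linkReal_nonneg ..)]
    exact Finset.prod_le_one (fun _ _ => linkReal_nonneg ..) fun _ _ => linkReal_le_one ..
  show ∫ w, ∏ i, linkReal n m (w.1 i) (w.2 j) (c i) ∂weightLaw P₁ P₂ n m = _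
  unfold weightLaw at hint ⊢
  rw [integral_prod_symm _ hint]
  have h2 : ∀ y : Fin m → ℝ≥0, (∫ x : Fin n → ℝ≥0, ∏ i, linkReal n m (x i) (y j) (c i)
      ∂Measure.pi fun _ => P₁) =
      ∏ i, (if c i then meanLink P₁ n m (y j) else 1 - meanLink P₁ n m (y j)) := by
    intro y
    rw [integral_fintype_prod_eq_prod fun i a => linkReal n m a (y j) (c i)]
    simp only [integral_linkReal]
  simp only [h2]
  refine integral_comp_eval (μ := fun _ : Fin m => P₂)
    (f := fun b => ∏ i, (if c i then meanLink P₁ n m b else 1 - meanLink P₁ n m b)) ?_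
  refine Measurable.aestronglyMeasurable (Finset.measurable_fun_prod _ fun i _ => ?_)
  split_ifs
  · exact measurable_meanLink P₁ n m
  · exact (measurable_meanLink P₁ n m).const_sub 1

/-- The event splits according to the exact set `R` of further holders of the attribute; all choices
of `R` are equally likely. -/
lemma incidenceLaw_real_columnEvent {u v : Fin n} (huv : u ≠ v) (j : Fin m) (r : ℕ) :
    (incidenceLaw P₁ P₂ n m).real (columnEvent n m u v j r) = columnProb P₁ P₂ n m r := by
  classical
  have hcard : ({u, v}ᶜ : Finset (Fin n)).card = n - 2 := by
    rw [Finset.card_compl, Finset.card_pair huv, Fintype.card_fin]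
  let E : Finset (Fin n) → Set (Incidence n m) := fun R =>
    {x | ∀ i, x (i, j) = decide (i ∈ R ∪ {u, v})}
  have hset : columnEvent n m u v j r =
      ⋃ R ∈ Finset.powersetCard r ({u, v}ᶜ : Finset (Fin n)), E R := by
    ext x
    simp only [Set.mem_iUnion, exists_prop, Finset.mem_powersetCard]
    constructor
    · rintro ⟨hu, hv, hr⟩
      refine ⟨_, ⟨fun w hw => ?_, hr⟩, fun i => ?_⟩
      · have := (Finset.mem_filter.1 hw).2
        simp [this.1, this.2.1]
      · rw [Bool.eq_iff_iff, decide_eq_true_iff]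
        simp only [Finset.mem_union, Finset.mem_filter, Finset.mem_univ, true_and,
          Finset.mem_insert, Finset.mem_singleton]
        by_cases hiu : i = u
        · simp [hiu, hu]
        by_cases hiv : i = v
        · simp [hiv, hv]
        simp [hiu, hiv]
    · rintro ⟨R, ⟨hR, hr⟩, hx⟩
      refine ⟨?_, ?_, ?_⟩
      · rw [hx u]; simp
      · rw [hx v]; simp
      · rw [← hr]
        congr 1
        ext w
        simp only [Finset.mem_filter, Finset.mem_univ, true_and, hx w, decide_eq_true_eq,
          Finset.mem_union, Finset.mem_insert, Finset.mem_singleton]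
        constructor
        · tauto
        · intro hw
          have := hR hw
          simp only [Finset.mem_compl, Finset.mem_insert, Finset.mem_singleton, not_or] at this
          exact ⟨this.1, this.2, Or.inl hw⟩
  have hdis : ∀ R ⊆ ({u, v}ᶜ : Finset (Fin n)), Disjoint R {u, v} := fun R hR =>
    disjoint_compl_left.mono_left hR
  rw [hset, measureReal_biUnion_finset]
  · have hE : ∀ R ∈ Finset.powersetCard r ({u, v}ᶜ : Finset (Fin n)),
        (incidenceLaw P₁ P₂ n m).real (E R) =
        ∫ b, (meanLink P₁ n m b ^ (r + 2) * (1 - meanLink P₁ n m b) ^ (n - 2 - r)) ∂P₂ := by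
      intro R hR
      obtain ⟨hR, hr⟩ := Finset.mem_powersetCard.1 hR
      rw [incidenceLaw_real_column]
      congr 1
      funext b
      have hc : (R ∪ {u, v}).card = r + 2 := by
        rw [Finset.card_union_of_disjoint (hdis R hR), hr, Finset.card_pair huv]
      simp only [decide_eq_true_eq]
      rw [Finset.prod_ite, Finset.prod_const, Finset.prod_const]
      congr 2
      · rw [Finset.filter_mem_eq_inter, Finset.univ_inter, hc]
      · rw [Finset.filter_not, Finset.card_sdiff_of_subset (Finset.filter_subset _ _),
          Finset.filter_mem_eq_inter, Finset.univ_inter, hc, Finset.card_univ, Fintype.card_fin]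
        omega
    rw [Finset.sum_congr rfl hE, Finset.sum_const, Finset.card_powersetCard, hcard, nsmul_eq_mul,
      columnProb, integral_const_mul]
  · intro R hR R' hR' hne
    refine Set.disjoint_left.2 fun x hx hx' => hne ?_
    have h1 := hdis R (Finset.mem_powersetCard.1 (Finset.mem_coe.1 hR)).1
    have h2 := hdis R' (Finset.mem_powersetCard.1 (Finset.mem_coe.1 hR')).1
    have h3 : R ∪ {u, v} = R' ∪ {u, v} := by
      ext i
      have := (hx i).symm.trans (hx' i)
      exact decide_eq_decide.1 this
    rw [← Finset.union_sdiff_cancel_right h1, h3, Finset.union_sdiff_cancel_right h2]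
  · exact fun _ _ => .of_discrete

lemma choose_mul_pow_mul_pow_le_one {p : ℝ} (h0 : 0 ≤ p) (h1 : p ≤ 1) (n r : ℕ) :
    (n.choose r : ℝ) * p ^ r * (1 - p) ^ (n - r) ≤ 1 := by
  rcases lt_or_ge n r with h | h
  · simp [Nat.choose_eq_zero_of_lt h]
  · have h2 : ∑ k ∈ Finset.range (n + 1), p ^ k * (1 - p) ^ (n - k) * (n.choose k : ℝ) = 1 := by
      rw [← add_pow]; simp
    refine le_trans (le_of_eq (by ring)) (h2 ▸ Finset.single_le_sum
      (f := fun k => p ^ k * (1 - p) ^ (n - k) * (n.choose k : ℝ))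
        (fun k _ => ?_) (Finset.mem_range.2 (Nat.lt_succ_of_le h)))
    have : 0 ≤ 1 - p := by linarith
    positivity

end

section

variable {P₁ P₂ : Measure ℝ≥0} [IsProbabilityMeasure P₁]

lemma mom_nonneg (P : Measure ℝ≥0) (k : ℕ) : 0 ≤ mom P k :=
  integral_nonneg fun _ => by positivity

lemma scaled_meanLink_le (hA : Integrable (fun x : ℝ≥0 => (x : ℝ) ^ 1) P₁) (n m : ℕ) (b : ℝ≥0) :
    Real.sqrt (n * m) * meanLink P₁ n m b ≤ mom P₁ 1 * b := by
  rw [meanLink, ← integral_const_mul, mom, ← integral_mul_const]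
  refine integral_mono ((integrable_linkProb P₁ n m b).const_mul _) (hA.mul_const _) fun a => ?_
  simpa using scaled_linkProb_le n m a b

lemma tendsto_scaled_meanLink (hA : Integrable (fun x : ℝ≥0 => (x : ℝ) ^ 1) P₁) {N M : ℕ → ℕ}
    (h : Tendsto (fun k => Real.sqrt (N k * M k)) atTop atTop) (b : ℝ≥0) :
    Tendsto (fun k => Real.sqrt (N k * M k) * meanLink P₁ (N k) (M k) b) atTop
      (𝓝 (mom P₁ 1 * b)) := by
  simp only [meanLink, mom, ← integral_const_mul, ← integral_mul_const]
  refine tendsto_integral_of_dominated_convergence (fun a => (a : ℝ) ^ 1 * b) (fun k => ?_)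
    (hA.mul_const _) (fun k => ae_of_all _ fun a => ?_) (ae_of_all _ fun a => ?_)
  · exact ((integrable_linkProb P₁ _ _ b).const_mul _).aestronglyMeasurable
  · rw [Real.norm_of_nonneg (mul_nonneg (Real.sqrt_nonneg _) (NNReal.coe_nonneg _)), pow_one]
    exact scaled_linkProb_le ..
  · rw [pow_one]
    exact tendsto_scaled_linkProb h a b

/-- The Poisson limit theorem for fixed `b`, followed by dominated convergence. Two factors
`meanLink` absorb the scale and supply the bound `(a₁ b)²`; the rest is a binomial probability, at
most `1`. -/
lemma tendsto_scaled_columnProb (hA : Integrable (fun x : ℝ≥0 => (x : ℝ) ^ 1) P₁)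
    (hB : Integrable (fun y : ℝ≥0 => (y : ℝ) ^ 2) P₂) {m : ℕ → ℕ} {β : ℝ}
    (h : Tendsto (fun n => Real.sqrt (n * m n)) atTop atTop)
    (hβ : Tendsto (fun n : ℕ => (n : ℝ) / Real.sqrt (n * m n)) atTop (𝓝 (Real.sqrt β)⁻¹)) (r : ℕ) :
    Tendsto (fun n => Real.sqrt (n * m n) ^ 2 * columnProb P₁ P₂ n (m n) r) atTop
      (𝓝 (∫ b, (mom P₁ 1 * b) ^ 2 * (Real.exp (-(mom P₁ 1 * b / Real.sqrt β)) *
        (mom P₁ 1 * b / Real.sqrt β) ^ r / r.factorial) ∂P₂)) := by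
  have he : ∀ n, Real.sqrt (n * m n) ^ 2 * columnProb P₁ P₂ n (m n) r =
      ∫ b, (Real.sqrt (n * m n) * meanLink P₁ n (m n) b) ^ 2 *
        ((n - 2).choose r * meanLink P₁ n (m n) b ^ r *
          (1 - meanLink P₁ n (m n) b) ^ (n - 2 - r)) ∂P₂ := by
    intro n
    rw [columnProb, ← integral_const_mul]
    congr 1
    funext b
    ring
  simp_rw [he]
  refine tendsto_integral_of_dominated_convergence (fun b => mom P₁ 1 ^ 2 * (b : ℝ) ^ 2)
    (fun n => ?_) (hB.const_mul _) (fun n => ae_of_all _ fun b => ?_) (ae_of_all _ fun b => ?_)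
  · have := measurable_meanLink P₁ n (m n)
    exact Measurable.aestronglyMeasurable (by fun_prop)
  · have h0 := meanLink_nonneg P₁ n (m n) b
    have h1 := meanLink_le_one P₁ n (m n) b
    have h2 : 0 ≤ 1 - meanLink P₁ n (m n) b := by linarith
    rw [Real.norm_of_nonneg (by positivity), ← mul_pow]
    refine (mul_le_of_le_one_right (by positivity)
      (choose_mul_pow_mul_pow_le_one h0 h1 (n - 2) r)).trans ?_
    exact pow_le_pow_left₀ (mul_nonneg (Real.sqrt_nonneg _) h0) (scaled_meanLink_le hA ..) 2
  · have hs := tendsto_scaled_meanLink hA (N := fun n => n) (M := m) h b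
    refine (hs.pow 2).mul ?_
    have hn : Tendsto (fun n : ℕ => (n : ℝ) * meanLink P₁ n (m n) b) atTop
        (𝓝 (mom P₁ 1 * b / Real.sqrt β)) := by
      have := hβ.mul hs
      rw [show (Real.sqrt β)⁻¹ * (mom P₁ 1 * b) = mom P₁ 1 * b / Real.sqrt β by ring] at this
      refine this.congr' ?_
      filter_upwards [h.eventually_gt_atTop 0] with n hn
      field_simp
    have hz := tendsto_zero_of_tendsto_mul_atTop (p := fun n => meanLink P₁ n (m n) b) hn
    -- Shifting the index turns the `n - 2` trials into `k` trials. The mean changes by `2 *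
    -- meanLink`, which tends to `0`.
    rw [← tendsto_add_atTop_iff_nat 2] at hn hz ⊢
    have hn2 : Tendsto (fun k : ℕ => (k : ℝ) * meanLink P₁ (k + 2) (m (k + 2)) b) atTop
        (𝓝 (mom P₁ 1 * b / Real.sqrt β)) := by
      have := hn.sub (hz.const_mul 2)
      rw [mul_zero, sub_zero] at this
      refine this.congr fun k => ?_
      push_cast
      ring
    exact tendsto_choose_mul_pow_of_tendsto_mul_atTop r hn2

end

/-! ### Averages over random vertices -/

/-- By Fubini the joint probability is an average over placements, so bounds valid for every
placement of distinct vertices carry over. -/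
lemma prod_uniformOn_real_mem_Icc {α κ : Type*} [Finite α] [Finite κ] [MeasurableSpace α]
    [MeasurableSpace κ] [MeasurableSingletonClass α] [MeasurableSingletonClass κ]
    (μ : Measure α) [IsProbabilityMeasure μ] {s : Set κ} (hs : s.Nonempty) (E : κ → Set α)
    {lo hi : ℝ} (h : ∀ p ∈ s, μ.real (E p) ∈ Set.Icc lo hi) :
    (μ.prod (uniformOn s)).real {ω | ω.1 ∈ E ω.2} ∈ Set.Icc lo hi := by
  have : IsProbabilityMeasure (uniformOn s) := isProbabilityMeasure_uniformOn s.toFinite hs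
  have he : (μ.prod (uniformOn s)).real {ω | ω.1 ∈ E ω.2} = ∫ p, μ.real (E p) ∂uniformOn s := by
    have hm : MeasurableSet {ω : α × κ | ω.1 ∈ E ω.2} := (Set.toFinite _).measurableSet
    rw [measureReal_def, Measure.prod_apply_symm hm, ← integral_toReal]
    · rfl
    · exact (measurable_of_countable _).aemeasurable
    · exact ae_of_all _ fun _ => measure_lt_top _ _
  have hae : ∀ᵐ p ∂uniformOn s, μ.real (E p) ∈ Set.Icc lo hi := by
    filter_upwards [ae_cond_mem s.toFinite.measurableSet] with p hp using h p hp
  have hint : Integrable (fun p => μ.real (E p)) (uniformOn s) := .of_finite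
  rw [he]
  constructor
  · have := integral_mono_ae (integrable_const lo) hint (hae.mono fun p hp => hp.1)
    simpa using this
  · have := integral_mono_ae hint (integrable_const hi) (hae.mono fun p hp => hp.2)
    simpa using this

/-- The joint law of the incidences and a random pair of vertices. -/
abbrev pairJoint (P₁ P₂ : Measure ℝ≥0) (n m : ℕ) : Measure (Incidence n m × Fin n × Fin n) :=
  (incidenceLaw P₁ P₂ n m).prod (pairLaw n)

/-- The joint law of the incidences and a random triple of vertices. -/
abbrev tripleJoint (P₁ P₂ : Measure ℝ≥0) (n m : ℕ) :
    Measure (Incidence n m × Fin n × Fin n × Fin n) :=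
  (incidenceLaw P₁ P₂ n m).prod (tripleLaw n)

section

variable (P₁ P₂ : Measure ℝ≥0) [IsProbabilityMeasure P₁] [IsProbabilityMeasure P₂]

instance (n : ℕ) : IsFiniteMeasure (pairLaw n) := by unfold pairLaw uniformOn; infer_instance

instance (n : ℕ) : IsFiniteMeasure (tripleLaw n) := by unfold tripleLaw uniformOn; infer_instance

lemma pairJoint_real_mem_Icc {n m : ℕ} (hn : 2 ≤ n) (p : Incidence n m → Fin n → Fin n → Prop)
    {lo hi : ℝ} (h : ∀ u v, u ≠ v → (incidenceLaw P₁ P₂ n m).real {x | p x u v} ∈ Set.Icc lo hi) :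
    (pairJoint P₁ P₂ n m).real {ω | p ω.1 ω.2.1 ω.2.2} ∈ Set.Icc lo hi :=
  prod_uniformOn_real_mem_Icc _ (s := {p : Fin n × Fin n | p.1 ≠ p.2})
    ⟨((⟨0, by omega⟩ : Fin n), (⟨1, by omega⟩ : Fin n)), by simp⟩
    (fun q => {x | p x q.1 q.2}) fun q hq => h q.1 q.2 hq

lemma tripleJoint_real_mem_Icc {n m : ℕ} (hn : 3 ≤ n)
    (p : Incidence n m → Fin n → Fin n → Fin n → Prop) {lo hi : ℝ}
    (h : ∀ u v w, u ≠ v → u ≠ w → v ≠ w →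
      (incidenceLaw P₁ P₂ n m).real {x | p x u v w} ∈ Set.Icc lo hi) :
    (tripleJoint P₁ P₂ n m).real {ω | p ω.1 ω.2.1 ω.2.2.1 ω.2.2.2} ∈ Set.Icc lo hi :=
  prod_uniformOn_real_mem_Icc _
    (s := {t : Fin n × Fin n × Fin n | t.1 ≠ t.2.1 ∧ t.1 ≠ t.2.2 ∧ t.2.1 ≠ t.2.2})
    ⟨((⟨0, by omega⟩ : Fin n), (⟨1, by omega⟩ : Fin n), (⟨2, by omega⟩ : Fin n)), by simp⟩
    (fun q => {x | p x q.1 q.2.1 q.2.2}) fun q hq => h q.1 q.2.1 q.2.2 hq.1 hq.2.1 hq.2.2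

/-- The probability that a random pair is adjacent and has `r` common neighbours. -/
def adjCodeg (n m r : ℕ) : ℝ := (pairJoint P₁ P₂ n m).real
  {ω | (interGraph ω.1).Adj ω.2.1 ω.2.2 ∧ codeg (interGraph ω.1) ω.2.1 ω.2.2 = r}

/-- The probability that a random pair is not adjacent and has `r` common neighbours. -/
def notAdjCodeg (n m r : ℕ) : ℝ := (pairJoint P₁ P₂ n m).real
  {ω | ¬ (interGraph ω.1).Adj ω.2.1 ω.2.2 ∧ codeg (interGraph ω.1) ω.2.1 ω.2.2 = r}

/-- The probability that a random triple is a triangle. -/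
def triangleProb (n m : ℕ) : ℝ := (tripleJoint P₁ P₂ n m).real
  {ω | ω.1 ∈ triangle n m ω.2.1 ω.2.2.1 ω.2.2.2}

/-- The probability that a random triple is a path with missing third edge. -/
def openPathProb (n m : ℕ) : ℝ := (tripleJoint P₁ P₂ n m).real
  {ω | ω.1 ∈ openPath n m ω.2.1 ω.2.2.1 ω.2.2.2}

/-- This form separates the two probabilities to be estimated. It also holds for a null event `B`,
where both sides are `0`. -/
lemma cond_toReal {α : Type*} [Finite α] [MeasurableSpace α] [MeasurableSingletonClass α]
    (μ : Measure α) [IsFiniteMeasure μ] (A B : Set α) :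
    (μ[A | B]).toReal = μ.real (A ∩ B) / (μ.real (A ∩ B) + μ.real (Aᶜ ∩ B)) := by
  have hA : MeasurableSet A := A.toFinite.measurableSet
  have hB : MeasurableSet B := B.toFinite.measurableSet
  have h : μ.real (A ∩ B) + μ.real (Aᶜ ∩ B) = μ.real B := by
    rw [← measureReal_inter_add_sdiff (μ := μ) (s := B) hA, Set.inter_comm B A, Set.sdiff_eq,
      Set.inter_comm B]
  rw [cond_apply hB, ENNReal.toReal_mul, ENNReal.toReal_inv, h, Set.inter_comm B A, div_eq_inv_mul]
  rfl

lemma clusteringFun_eq (n m r : ℕ) : clusteringFun P₁ P₂ n m r =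
    adjCodeg P₁ P₂ n m r / (adjCodeg P₁ P₂ n m r + notAdjCodeg P₁ P₂ n m r) :=
  cond_toReal _ _ _

lemma clusteringCoeff_eq (n m : ℕ) : clusteringCoeff P₁ P₂ n m =
    triangleProb P₁ P₂ n m / (triangleProb P₁ P₂ n m + openPathProb P₁ P₂ n m) :=
  cond_toReal _ _ _

lemma adjCodeg_mem_Icc {n : ℕ} (m : ℕ) (hn : 2 ≤ n) (r : ℕ) : adjCodeg P₁ P₂ n m r ∈
    Set.Icc (m * columnProb P₁ P₂ n m r - edgeErr P₁ P₂ n m)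
      (m * columnProb P₁ P₂ n m r + edgeErr P₁ P₂ n m) := by
  refine pairJoint_real_mem_Icc P₁ P₂ hn
    (fun x u v => (interGraph x).Adj u v ∧ codeg (interGraph x) u v = r) fun u v huv => ?_
  have h1 := real_adj_codeg_le P₁ P₂ (m := m) huv r
  have h2 := le_real_adj_codeg P₁ P₂ (m := m) huv r
  simp only [incidenceLaw_real_columnEvent P₁ P₂ huv, Finset.sum_const, Finset.card_univ,
    Fintype.card_fin, nsmul_eq_mul] at h1 h2
  exact ⟨h2, h1⟩

/-- One copy of the four-vertex error comes from the overlaps in counting `d ≥ 1`, the other from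
discarding `d ≥ 2`. -/
lemma notAdjCodeg_one_mem_Icc {n : ℕ} (m : ℕ) (hn : 2 ≤ n) : notAdjCodeg P₁ P₂ n m 1 ∈
    Set.Icc ((n - 2) * (m * ((m : ℝ) - 1) * patternProb P₁ P₂ n m patPath - pathErr P₁ P₂ n m) -
      2 * ((n : ℝ) ^ 2 * fourErr P₁ P₂ n m))
      ((n - 2) * (m * ((m : ℝ) - 1) * patternProb P₁ P₂ n m patPath)) := by
  refine pairJoint_real_mem_Icc P₁ P₂ hn
    (fun x u v => ¬ (interGraph x).Adj u v ∧ codeg (interGraph x) u v = 1) fun u v huv => ⟨?_, ?_⟩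
  · have h1 := le_real_notAdj_codeg P₁ P₂ (m := m) huv
    have h2 := real_notAdj_two_le_codeg_le P₁ P₂ (m := m) huv
    have hsub : {x : Incidence n m | ¬ (interGraph x).Adj u v ∧ 1 ≤ codeg (interGraph x) u v} ⊆
        {x | ¬ (interGraph x).Adj u v ∧ codeg (interGraph x) u v = 1} ∪
        {x | ¬ (interGraph x).Adj u v ∧ 2 ≤ codeg (interGraph x) u v} := by
      rintro x ⟨hx, h⟩
      rcases h.eq_or_lt with h | h
      · exact Or.inl ⟨hx, h.symm⟩
      · exact Or.inr ⟨hx, h⟩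
    have h3 := (real_mono (μ := incidenceLaw P₁ P₂ n m) hsub).trans (measureReal_union_le _ _)
    linarith
  · refine (real_mono ?_).trans (real_notAdj_codeg_le P₁ P₂ huv)
    exact fun x hx => ⟨hx.1, hx.2.ge⟩

lemma notAdjCodeg_mem_Icc {n : ℕ} (m : ℕ) (hn : 2 ≤ n) {r : ℕ} (hr : 2 ≤ r) :
    notAdjCodeg P₁ P₂ n m r ∈ Set.Icc 0 ((n : ℝ) ^ 2 * fourErr P₁ P₂ n m) := by
  refine pairJoint_real_mem_Icc P₁ P₂ hn
    (fun x u v => ¬ (interGraph x).Adj u v ∧ codeg (interGraph x) u v = r)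
    fun u v huv => ⟨measureReal_nonneg, ?_⟩
  refine (real_mono ?_).trans (real_notAdj_two_le_codeg_le P₁ P₂ huv)
  exact fun x hx => ⟨hx.1, hx.2 ▸ hr⟩

lemma codeg_zero_mem_Icc {n : ℕ} (m : ℕ) (hn : 2 ≤ n) :
    adjCodeg P₁ P₂ n m 0 + notAdjCodeg P₁ P₂ n m 0 ∈
    Set.Icc (1 - (m * patternProb P₁ P₂ n m patEdge +
      (n - 2) * (m * ((m : ℝ) - 1) * patternProb P₁ P₂ n m patPath))) 1 := by
  have h : adjCodeg P₁ P₂ n m 0 + notAdjCodeg P₁ P₂ n m 0 =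
      (pairJoint P₁ P₂ n m).real {ω | codeg (interGraph ω.1) ω.2.1 ω.2.2 = 0} := by
    have hA : MeasurableSet {ω : Incidence n m × Fin n × Fin n |
      (interGraph ω.1).Adj ω.2.1 ω.2.2} := (Set.toFinite _).measurableSet
    rw [← measureReal_inter_add_sdiff (μ := pairJoint P₁ P₂ n m) (t := {ω |
      (interGraph ω.1).Adj ω.2.1 ω.2.2}) hA, Set.inter_comm, Set.sdiff_eq, Set.inter_comm _ (_)ᶜ]
    rfl
  rw [h]
  refine pairJoint_real_mem_Icc P₁ P₂ hn (fun x u v => codeg (interGraph x) u v = 0)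
    fun u v huv => ⟨?_, measureReal_le_one⟩
  have h1 := real_adj_le P₁ P₂ (m := m) huv
  have h2 := real_notAdj_codeg_le P₁ P₂ (m := m) huv
  have hsub : (Set.univ : Set (Incidence n m)) ⊆ {x | codeg (interGraph x) u v = 0} ∪
      ({x | (interGraph x).Adj u v} ∪
      {x | ¬ (interGraph x).Adj u v ∧ 1 ≤ codeg (interGraph x) u v}) := by
    intro x _
    by_cases h0 : codeg (interGraph x) u v = 0
    · exact Or.inl h0
    by_cases h1 : (interGraph x).Adj u v
    · exact Or.inr (Or.inl h1)
    · exact Or.inr (Or.inr ⟨h1, Nat.one_le_iff_ne_zero.2 h0⟩)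
  have h3 := (real_mono (μ := incidenceLaw P₁ P₂ n m) hsub).trans ((measureReal_union_le _ _).trans
    (add_le_add le_rfl (measureReal_union_le _ _)))
  rw [probReal_univ] at h3
  linarith

lemma triangleProb_mem_Icc {n : ℕ} (m : ℕ) (hn : 3 ≤ n) : triangleProb P₁ P₂ n m ∈
    Set.Icc (m * patternProb P₁ P₂ n m patStar - triErr P₁ P₂ n m)
      (m * patternProb P₁ P₂ n m patStar + triErr P₁ P₂ n m) :=
  tripleJoint_real_mem_Icc P₁ P₂ hn (fun x u v w => x ∈ triangle n m u v w)
    fun _ _ _ huv huw hvw =>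
      ⟨le_real_triangle P₁ P₂ huv huw hvw, real_triangle_le P₁ P₂ huv huw hvw⟩

lemma openPathProb_mem_Icc {n : ℕ} (m : ℕ) (hn : 3 ≤ n) : openPathProb P₁ P₂ n m ∈
    Set.Icc (m * ((m : ℝ) - 1) * patternProb P₁ P₂ n m patPath - pathErr P₁ P₂ n m)
      (m * ((m : ℝ) - 1) * patternProb P₁ P₂ n m patPath) :=
  tripleJoint_real_mem_Icc P₁ P₂ hn (fun x u v w => x ∈ openPath n m u v w)
    fun _ _ _ huv huw hvw =>
      ⟨le_real_openPath P₁ P₂ huv huw hvw, real_openPath_le P₁ P₂ huv huw hvw⟩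

end

/-! ### Growth of the scale `√(n m)` -/

section

variable {m : ℕ → ℕ} {β : ℝ}

lemma tendsto_sqrt_div (hm : Tendsto (fun n : ℕ => (m n : ℝ) / (n : ℝ)) atTop (𝓝 β)) :
    Tendsto (fun n : ℕ => Real.sqrt (n * m n) / n) atTop (𝓝 (Real.sqrt β)) := by
  refine (hm.sqrt).congr' ?_
  filter_upwards [eventually_gt_atTop 0] with n hn
  have hn' : (0 : ℝ) < n := by exact_mod_cast hn
  rw [eq_div_iff hn'.ne']
  nth_rewrite 2 [← Real.sqrt_sq hn'.le]
  rw [← Real.sqrt_mul (by positivity)]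
  congr 1
  field_simp

lemma tendsto_sqrt_atTop (hβ : 0 < β)
    (hm : Tendsto (fun n : ℕ => (m n : ℝ) / (n : ℝ)) atTop (𝓝 β)) :
    Tendsto (fun n : ℕ => Real.sqrt (n * m n)) atTop atTop := by
  refine ((tendsto_sqrt_div hm).pos_mul_atTop (Real.sqrt_pos.2 hβ)
    tendsto_natCast_atTop_atTop).congr' ?_
  filter_upwards [eventually_gt_atTop 0] with n hn
  have hn' : (0 : ℝ) < n := by exact_mod_cast hn
  field_simp

lemma tendsto_div_sqrt (hβ : 0 < β)
    (hm : Tendsto (fun n : ℕ => (m n : ℝ) / (n : ℝ)) atTop (𝓝 β)) :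
    Tendsto (fun n : ℕ => (n : ℝ) / Real.sqrt (n * m n)) atTop (𝓝 (Real.sqrt β)⁻¹) := by
  refine ((tendsto_sqrt_div hm).inv₀ (Real.sqrt_pos.2 hβ).ne').congr fun n => ?_
  rw [inv_div]

lemma tendsto_attr_div_sqrt (hβ : 0 < β)
    (hm : Tendsto (fun n : ℕ => (m n : ℝ) / (n : ℝ)) atTop (𝓝 β)) :
    Tendsto (fun n : ℕ => (m n : ℝ) / Real.sqrt (n * m n)) atTop (𝓝 (Real.sqrt β)) := by
  refine (tendsto_sqrt_div hm).congr' ?_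
  filter_upwards [eventually_gt_atTop 0, (tendsto_sqrt_atTop hβ hm).eventually_gt_atTop 0]
    with n hn hL
  have hn' : (0 : ℝ) < n := by exact_mod_cast hn
  rw [div_eq_div_iff hn'.ne' hL.ne', Real.mul_self_sqrt (by positivity)]
  ring

/-- With `L = √(n m)`, the factors `n / L` and `m / L` tend to `1/√β` and `√β`, so each summed
vertex or attribute costs one power of `L`. -/
lemma tendsto_count_mul (hβ : 0 < β)
    (hm : Tendsto (fun n : ℕ => (m n : ℝ) / (n : ℝ)) atTop (𝓝 β)) {X : ℕ → ℝ} {c : ℝ} (i j : ℕ)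
    (hX : Tendsto (fun n : ℕ => Real.sqrt (n * m n) ^ (i + j) * X n) atTop (𝓝 c)) :
    Tendsto (fun n : ℕ => (n : ℝ) ^ i * (m n : ℝ) ^ j * X n) atTop
      (𝓝 ((Real.sqrt β)⁻¹ ^ i * Real.sqrt β ^ j * c)) := by
  refine ((((tendsto_div_sqrt hβ hm).pow i).mul ((tendsto_attr_div_sqrt hβ hm).pow j)).mul
    hX).congr' ?_
  filter_upwards [(tendsto_sqrt_atTop hβ hm).eventually_gt_atTop 0] with n hL
  generalize Real.sqrt (n * m n) = L at hL
  rw [pow_add, div_pow, div_pow]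
  field_simp

lemma tendsto_count_mul_zero (hβ : 0 < β)
    (hm : Tendsto (fun n : ℕ => (m n : ℝ) / (n : ℝ)) atTop (𝓝 β)) {X : ℕ → ℝ} {c : ℝ} (i j k : ℕ)
    (hk : i + j < k)
    (hX : Tendsto (fun n : ℕ => Real.sqrt (n * m n) ^ k * X n) atTop (𝓝 c)) :
    Tendsto (fun n : ℕ => (n : ℝ) ^ i * (m n : ℝ) ^ j * X n) atTop (𝓝 0) := by
  have hL := tendsto_sqrt_atTop hβ hm
  have h0 : Tendsto (fun n : ℕ => Real.sqrt (n * m n) ^ (i + j) * X n) atTop (𝓝 0) := by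
    have h1 := hX.mul (hL.inv_tendsto_atTop.pow (k - (i + j)))
    rw [zero_pow (by omega), mul_zero] at h1
    refine h1.congr' ?_
    filter_upwards [hL.eventually_gt_atTop 0] with n hn
    obtain ⟨d, rfl⟩ := Nat.exists_eq_add_of_lt hk
    simp only [Pi.inv_apply]
    generalize Real.sqrt (n * m n) = L at hn
    rw [show i + j + d + 1 - (i + j) = d + 1 by omega, add_assoc, pow_add, inv_pow]
    field_simp
  simpa using tendsto_count_mul hβ hm i j h0

end

lemma tendsto_inv_mul_zero {X : ℕ → ℝ} {c : ℝ} (h : Tendsto X atTop (𝓝 c)) :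
    Tendsto (fun n : ℕ => (n : ℝ)⁻¹ * X n) atTop (𝓝 0) := by
  simpa using tendsto_inv_atTop_nhds_zero_nat.mul h

/-! ### Positivity of moments and of the limiting constants -/

lemma mom_pos_of_mom_pos {P : Measure ℝ≥0} [IsProbabilityMeasure P] {k l : ℕ} (hl : l ≠ 0)
    (hk : Integrable (fun x : ℝ≥0 => (x : ℝ) ^ k) P) (h : 0 < mom P l) : 0 < mom P k := by
  refine (mom_nonneg P k).lt_of_ne fun h0 => h.ne ?_
  have h1 := (integral_eq_zero_iff_of_nonneg (fun x : ℝ≥0 => by positivity) hk).1 h0.symm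
  refine (integral_eq_zero_of_ae ?_).symm
  filter_upwards [h1] with x hx
  have hx' : (x : ℝ) = 0 := by
    by_contra hne
    exact pow_ne_zero k hne hx
  simp [hx', hl]

/-- The limit of `n` times the probability of `r` common neighbours of adjacent vertices. -/
def poissonMoment (P₁ P₂ : Measure ℝ≥0) (β : ℝ) (r : ℕ) : ℝ :=
  ∫ b, (mom P₁ 1 * b) ^ 2 * (Real.exp (-(mom P₁ 1 * b / Real.sqrt β)) *
    (mom P₁ 1 * b / Real.sqrt β) ^ r / r.factorial) ∂P₂

lemma poissonMoment_zero (P₁ P₂ : Measure ℝ≥0) (β : ℝ) :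
    poissonMoment P₁ P₂ β 0 = mom P₁ 1 ^ 2 * momStar P₁ P₂ β 2 := by
  rw [poissonMoment, momStar, ← integral_const_mul]
  congr 1
  funext b
  simp
  ring

lemma poissonMoment_one (P₁ P₂ : Measure ℝ≥0) (β : ℝ) :
    poissonMoment P₁ P₂ β 1 = mom P₁ 1 ^ 3 / Real.sqrt β * momStar P₁ P₂ β 3 := by
  rw [poissonMoment, momStar, ← integral_const_mul]
  congr 1
  funext b
  simp
  ring

/-- The integrand is positive for `b ≠ 0`, so a zero integral would concentrate `P₂` at `0`.
Integrability holds because a Poisson weight is at most `1`. -/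
lemma poissonMoment_pos {P₁ P₂ : Measure ℝ≥0} {β : ℝ} (hβ : 0 < β) (h1 : 0 < mom P₁ 1)
    (hB : Integrable (fun y : ℝ≥0 => (y : ℝ) ^ 2) P₂) (h2 : 0 < mom P₂ 2) (r : ℕ) :
    0 < poissonMoment P₁ P₂ β r := by
  have hs : 0 < Real.sqrt β := Real.sqrt_pos.2 hβ
  have hint : Integrable (fun b : ℝ≥0 => (mom P₁ 1 * b) ^ 2 *
      (Real.exp (-(mom P₁ 1 * b / Real.sqrt β)) *
      (mom P₁ 1 * b / Real.sqrt β) ^ r / r.factorial)) P₂ := by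
    refine (hB.const_mul (mom P₁ 1 ^ 2)).mono'
      (Measurable.aestronglyMeasurable (by fun_prop)) (ae_of_all _ fun b => ?_)
    rw [Real.norm_of_nonneg (by positivity), ← mul_pow]
    refine mul_le_of_le_one_right (by positivity) ?_
    rw [mul_div_assoc, Real.exp_neg, inv_mul_le_one₀ (Real.exp_pos _)]
    exact Real.pow_div_factorial_le_exp _ (by positivity) r
  refine (integral_nonneg fun b => by positivity).lt_of_ne fun h0 => h2.ne ?_
  have h3 := (integral_eq_zero_iff_of_nonneg (fun b => by positivity) hint).1 h0.symm
  refine (integral_eq_zero_of_ae ?_).symm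
  filter_upwards [h3] with b hb
  have hb0 : (b : ℝ) = 0 := by
    by_contra hne
    have hpos : (0 : ℝ) < b := lt_of_le_of_ne b.coe_nonneg (Ne.symm hne)
    have : 0 < (mom P₁ 1 * b) ^ 2 * (Real.exp (-(mom P₁ 1 * b / Real.sqrt β)) *
      (mom P₁ 1 * b / Real.sqrt β) ^ r / r.factorial) := by positivity
    exact this.ne' hb
  simp [hb0]

/-! ### Limits of the scaled edge, path and triangle probabilities -/

section

variable {P₁ P₂ : Measure ℝ≥0} [IsProbabilityMeasure P₁] [IsProbabilityMeasure P₂]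
  (hA : Integrable (fun x : ℝ≥0 => (x : ℝ) ^ 2) P₁)
  (hB : Integrable (fun y : ℝ≥0 => (y : ℝ) ^ 3) P₂)
  {m : ℕ → ℕ} {β : ℝ} (hβ : 0 < β)
  (hm : Tendsto (fun n : ℕ => (m n : ℝ) / (n : ℝ)) atTop (𝓝 β))

include hA hB hβ hm

lemma tendsto_patternProb {a b : ℕ} (S : Finset (Fin a × Fin b)) (hv : ∀ i, vdeg S i ≤ 2)
    (ha : ∀ j, adeg S j ≤ 3) (i j : ℕ) (hij : i + j = S.card) :
    Tendsto (fun n : ℕ => (n : ℝ) ^ i * (m n : ℝ) ^ j * patternProb P₁ P₂ n (m n) S) atTop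
      (𝓝 ((Real.sqrt β)⁻¹ ^ i * Real.sqrt β ^ j *
        ((∏ i, mom P₁ (vdeg S i)) * ∏ j, mom P₂ (adeg S j)))) := by
  refine tendsto_count_mul hβ hm i j ?_
  rw [hij]
  exact tendsto_scaled_patternProb hA hB (N := fun n => n) (tendsto_sqrt_atTop hβ hm) S hv ha

lemma tendsto_patternProb_zero {a b : ℕ} (S : Finset (Fin a × Fin b)) (hv : ∀ i, vdeg S i ≤ 2)
    (ha : ∀ j, adeg S j ≤ 3) (i j : ℕ) (hij : i + j < S.card) :
    Tendsto (fun n : ℕ => (n : ℝ) ^ i * (m n : ℝ) ^ j * patternProb P₁ P₂ n (m n) S) atTop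
      (𝓝 0) :=
  tendsto_count_mul_zero hβ hm i j _ hij
    (tendsto_scaled_patternProb hA hB (N := fun n => n) (tendsto_sqrt_atTop hβ hm) S hv ha)

lemma tendsto_patternProb_union {a b : ℕ} (S T : Finset (Fin a × Fin b)) (hST : Disjoint S T)
    (hT : T.Nonempty) (hv : ∀ i, vdeg S i ≤ 2) (ha : ∀ j, adeg S j ≤ 3) (i j : ℕ)
    (hij : i + j = S.card) :
    Tendsto (fun n : ℕ => (n : ℝ) ^ i * (m n : ℝ) ^ j * patternProb P₁ P₂ n (m n) (S ∪ T)) atTop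
      (𝓝 0) := by
  have := tendsto_scaled_patternProb_union hA hB (N := fun n => n) (tendsto_sqrt_atTop hβ hm)
    S T hST hT hv ha
  rw [← hij] at this
  simpa using tendsto_count_mul hβ hm i j this

lemma tendsto_edgeErr : Tendsto (fun n : ℕ => n * edgeErr P₁ P₂ n (m n)) atTop (𝓝 0) := by
  have h1 := tendsto_patternProb_zero hA hB hβ hm patK22 (by decide) (by decide) 1 2 (by decide)
  have h2 := tendsto_patternProb_zero hA hB hβ hm patTri (by decide) (by decide) 2 3 (by decide)
  simpa using (h1.add h2).congr fun n => by rw [edgeErr]; ring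

lemma tendsto_pathErr : Tendsto (fun n : ℕ => n ^ 2 * pathErr P₁ P₂ n (m n)) atTop (𝓝 0) := by
  have h1 := tendsto_patternProb_zero hA hB hβ hm patPathL (by decide) (by decide) 2 2 (by decide)
  have h2 := tendsto_patternProb_zero hA hB hβ hm patPathR (by decide) (by decide) 2 2 (by decide)
  have h3 := tendsto_patternProb_zero hA hB hβ hm patTri (by decide) (by decide) 2 3 (by decide)
  -- Vertex `2` has degree `3` here, beyond the second moment of `P₁`. Splitting off `(2, 2)` leaves
  -- five incidences that exactly balance `n² m³`, and the split factor forces the limit `0`.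
  have h4 := tendsto_patternProb_union hA hB hβ hm
    ({(0, 0), (2, 0), (1, 1), (2, 1), (0, 2)} : Finset (Fin 3 × Fin 3)) {(2, 2)}
    (by decide) (by decide) (by decide) (by decide) 2 3 (by decide)
  have h5 := tendsto_patternProb_union hA hB hβ hm
    ({(0, 0), (2, 0), (1, 1), (2, 1), (1, 2)} : Finset (Fin 3 × Fin 3)) {(2, 2)}
    (by decide) (by decide) (by decide) (by decide) 2 3 (by decide)
  simpa using ((h1.add h2).add ((h3.add h4).add h5)).congr fun n => by rw [pathErr]; ring

lemma tendsto_triErr : Tendsto (fun n : ℕ => n ^ 2 * triErr P₁ P₂ n (m n)) atTop (𝓝 0) := by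
  have h1 := tendsto_patternProb_zero hA hB hβ hm patK32 (by decide) (by decide) 2 2 (by decide)
  have h2 := tendsto_patternProb_zero hA hB hβ hm patTri (by decide) (by decide) 2 3 (by decide)
  simpa using (h1.add h2).congr fun n => by rw [triErr]; ring

lemma tendsto_fourErr : Tendsto (fun n : ℕ => n ^ 3 * fourErr P₁ P₂ n (m n)) atTop (𝓝 0) := by
  have h1 := tendsto_patternProb_zero hA hB hβ hm patFour2 (by decide) (by decide) 3 2 (by decide)
  have h2 := tendsto_patternProb_zero hA hB hβ hm patFourL (by decide) (by decide) 3 3 (by decide)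
  have h3 := tendsto_patternProb_zero hA hB hβ hm patFourR (by decide) (by decide) 3 3 (by decide)
  have h4 := tendsto_patternProb_zero hA hB hβ hm patFour4 (by decide) (by decide) 3 4 (by decide)
  simpa using ((h1.add (h2.add h3)).add h4).congr fun n => by rw [fourErr]; ring

lemma tendsto_patPath : Tendsto
    (fun n : ℕ => (n : ℝ) ^ 2 * (m n * ((m n : ℝ) - 1) * patternProb P₁ P₂ n (m n) patPath)) atTop
    (𝓝 (mom P₁ 1 ^ 2 * mom P₁ 2 * mom P₂ 2 ^ 2)) := by
  have h1 := tendsto_patternProb hA hB hβ hm patPath (by decide) (by decide) 2 2 (by decide)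
  -- This is the lower-order part of `m (m - 1) = m² - m`.
  have h2 := tendsto_patternProb_zero hA hB hβ hm patPath (by decide) (by decide) 2 1 (by decide)
  have hs : Real.sqrt β ≠ 0 := (Real.sqrt_pos.2 hβ).ne'
  have e : (Real.sqrt β)⁻¹ ^ 2 * Real.sqrt β ^ 2 *
      ((∏ i, mom P₁ (vdeg patPath i)) * ∏ j, mom P₂ (adeg patPath j)) - 0 =
      mom P₁ 1 ^ 2 * mom P₁ 2 * mom P₂ 2 ^ 2 := by
    rw [Fin.prod_univ_three, Fin.prod_univ_two, show vdeg patPath 0 = 1 by decide,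
      show vdeg patPath 1 = 1 by decide, show vdeg patPath 2 = 2 by decide,
      show adeg patPath 0 = 2 by decide, show adeg patPath 1 = 2 by decide]
    field_simp
    ring
  rw [← e]
  exact (h1.sub h2).congr fun n => by ring

lemma tendsto_patStar : Tendsto
    (fun n : ℕ => (n : ℝ) ^ 2 * (m n * patternProb P₁ P₂ n (m n) patStar)) atTop
    (𝓝 (mom P₁ 1 ^ 3 * mom P₂ 3 / Real.sqrt β)) := by
  have h1 := tendsto_patternProb hA hB hβ hm patStar (by decide) (by decide) 2 1 (by decide)
  have hs : Real.sqrt β ≠ 0 := (Real.sqrt_pos.2 hβ).ne'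
  have e : (Real.sqrt β)⁻¹ ^ 2 * Real.sqrt β ^ 1 *
      ((∏ i, mom P₁ (vdeg patStar i)) * ∏ j, mom P₂ (adeg patStar j)) =
      mom P₁ 1 ^ 3 * mom P₂ 3 / Real.sqrt β := by
    rw [Fin.prod_univ_three, Fin.prod_univ_one, show vdeg patStar 0 = 1 by decide,
      show vdeg patStar 1 = 1 by decide, show vdeg patStar 2 = 1 by decide,
      show adeg patStar 0 = 3 by decide]
    field_simp
  rw [← e]
  exact h1.congr fun n => by ring

lemma tendsto_adjCodeg (r : ℕ) : Tendsto (fun n : ℕ => n * adjCodeg P₁ P₂ n (m n) r) atTop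
    (𝓝 (poissonMoment P₁ P₂ β r)) := by
  have h1 := tendsto_scaled_columnProb (integrable_pow_of_le hA one_le_two)
    (integrable_pow_of_le hB (by norm_num)) (tendsto_sqrt_atTop hβ hm) (tendsto_div_sqrt hβ hm) r
  have he := tendsto_edgeErr hA hB hβ hm
  have h2 : Tendsto (fun n : ℕ => (n : ℝ) * (m n * columnProb P₁ P₂ n (m n) r)) atTop
      (𝓝 (poissonMoment P₁ P₂ β r)) :=
    h1.congr fun n => by rw [Real.sq_sqrt (by positivity), mul_assoc]
  refine tendsto_of_tendsto_of_tendsto_of_le_of_le' (by simpa using h2.sub he)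
    (by simpa using h2.add he) ?_ ?_
  · filter_upwards [eventually_ge_atTop 2] with n hn
    have := mul_le_mul_of_nonneg_left (adjCodeg_mem_Icc P₁ P₂ (m n) hn r).1 n.cast_nonneg
    linarith
  · filter_upwards [eventually_ge_atTop 2] with n hn
    have := mul_le_mul_of_nonneg_left (adjCodeg_mem_Icc P₁ P₂ (m n) hn r).2 n.cast_nonneg
    linarith

lemma tendsto_notAdjCodeg_one : Tendsto (fun n : ℕ => n * notAdjCodeg P₁ P₂ n (m n) 1) atTop
    (𝓝 (mom P₁ 1 ^ 2 * mom P₁ 2 * mom P₂ 2 ^ 2)) := by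
  have hp := tendsto_patPath hA hB hβ hm
  have he := tendsto_pathErr hA hB hβ hm
  have hf := tendsto_fourErr hA hB hβ hm
  -- The `2/n` corrections come from `n (n - 2) = n² - 2n`, as the common neighbour avoids two
  -- vertices.
  have hp' := (tendsto_inv_mul_zero hp).const_mul 2
  have he' := (tendsto_inv_mul_zero he).const_mul 2
  refine tendsto_of_tendsto_of_tendsto_of_le_of_le'
    (by simpa using ((hp.sub hp').sub (he.sub he')).sub (hf.const_mul 2))
    (by simpa using hp.sub hp') ?_ ?_
  · filter_upwards [eventually_ge_atTop 2] with n hn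
    have := mul_le_mul_of_nonneg_left (notAdjCodeg_one_mem_Icc P₁ P₂ (m n) hn).1 n.cast_nonneg
    refine le_trans (le_of_eq ?_) this
    have : (n : ℝ) ≠ 0 := by positivity
    field_simp
  · filter_upwards [eventually_ge_atTop 2] with n hn
    have := mul_le_mul_of_nonneg_left (notAdjCodeg_one_mem_Icc P₁ P₂ (m n) hn).2 n.cast_nonneg
    refine this.trans (le_of_eq ?_)
    have : (n : ℝ) ≠ 0 := by positivity
    field_simp

lemma tendsto_notAdjCodeg {r : ℕ} (hr : 2 ≤ r) :
    Tendsto (fun n : ℕ => n * notAdjCodeg P₁ P₂ n (m n) r) atTop (𝓝 0) := by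
  refine tendsto_of_tendsto_of_tendsto_of_le_of_le' tendsto_const_nhds
    (tendsto_fourErr hA hB hβ hm) ?_ ?_
  · filter_upwards [eventually_ge_atTop 2] with n hn
    exact mul_nonneg n.cast_nonneg (notAdjCodeg_mem_Icc P₁ P₂ (m n) hn hr).1
  · filter_upwards [eventually_ge_atTop 2] with n hn
    have := mul_le_mul_of_nonneg_left (notAdjCodeg_mem_Icc P₁ P₂ (m n) hn hr).2 n.cast_nonneg
    exact this.trans (le_of_eq (by ring))

lemma tendsto_codeg_zero :
    Tendsto (fun n : ℕ => adjCodeg P₁ P₂ n (m n) 0 + notAdjCodeg P₁ P₂ n (m n) 0) atTop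
      (𝓝 1) := by
  have hp := tendsto_inv_mul_zero (tendsto_patPath hA hB hβ hm)
  have hp' := (tendsto_inv_mul_zero hp).const_mul 2
  have h1 := tendsto_patternProb_zero hA hB hβ hm patEdge (by decide) (by decide) 0 1 (by decide)
  refine tendsto_of_tendsto_of_tendsto_of_le_of_le'
    (by simpa using (h1.add (hp.sub hp')).const_sub 1) tendsto_const_nhds ?_ ?_
  · filter_upwards [eventually_ge_atTop 2] with n hn
    refine le_trans (le_of_eq ?_) (codeg_zero_mem_Icc P₁ P₂ (m n) hn).1
    have : (n : ℝ) ≠ 0 := by positivity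
    field_simp
  · filter_upwards [eventually_ge_atTop 2] with n hn
    exact (codeg_zero_mem_Icc P₁ P₂ (m n) hn).2

lemma tendsto_triangleProb : Tendsto (fun n : ℕ => n ^ 2 * triangleProb P₁ P₂ n (m n)) atTop
    (𝓝 (mom P₁ 1 ^ 3 * mom P₂ 3 / Real.sqrt β)) := by
  have h2 := tendsto_patStar hA hB hβ hm
  have he := tendsto_triErr hA hB hβ hm
  refine tendsto_of_tendsto_of_tendsto_of_le_of_le' (by simpa using h2.sub he)
    (by simpa using h2.add he) ?_ ?_
  · filter_upwards [eventually_ge_atTop 3] with n hn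
    have := mul_le_mul_of_nonneg_left (triangleProb_mem_Icc P₁ P₂ (m n) hn).1
      (sq_nonneg (n : ℝ))
    linarith
  · filter_upwards [eventually_ge_atTop 3] with n hn
    have := mul_le_mul_of_nonneg_left (triangleProb_mem_Icc P₁ P₂ (m n) hn).2
      (sq_nonneg (n : ℝ))
    linarith

lemma tendsto_openPathProb : Tendsto (fun n : ℕ => n ^ 2 * openPathProb P₁ P₂ n (m n)) atTop
    (𝓝 (mom P₁ 1 ^ 2 * mom P₁ 2 * mom P₂ 2 ^ 2)) := by
  have h2 := tendsto_patPath hA hB hβ hm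
  have he := tendsto_pathErr hA hB hβ hm
  refine tendsto_of_tendsto_of_tendsto_of_le_of_le' (by simpa using h2.sub he) h2 ?_ ?_
  · filter_upwards [eventually_ge_atTop 3] with n hn
    have := mul_le_mul_of_nonneg_left (openPathProb_mem_Icc P₁ P₂ (m n) hn).1
      (sq_nonneg (n : ℝ))
    linarith
  · filter_upwards [eventually_ge_atTop 3] with n hn
    exact mul_le_mul_of_nonneg_left (openPathProb_mem_Icc P₁ P₂ (m n) hn).2 (sq_nonneg (n : ℝ))

end

/-! ### Limits of the ratios and conclusion -/

/-- The quotient of the two limits is `c κ / s`. Taking `c = b₃` gives the clustering coefficient,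
and `c = b₃*` gives `cl(1)`. -/
lemma kappa_ratio {P₁ P₂ : Measure ℝ≥0} {s c : ℝ} (hs : 0 < s) (hc : 0 < c) (h1 : 0 < mom P₁ 1)
    (h2 : 0 < mom P₁ 2) (h3 : 0 < mom P₂ 2) :
    mom P₁ 1 ^ 3 * c / s / (mom P₁ 1 ^ 3 * c / s + mom P₁ 1 ^ 2 * mom P₁ 2 * mom P₂ 2 ^ 2) =
      c * kappa P₁ P₂ / (c * kappa P₁ P₂ + s) := by
  unfold kappa
  field_simp

lemma tendsto_ratio_of_scaled {X Y s : ℕ → ℝ} {p q : ℝ} (hpq : p + q ≠ 0)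
    (hs : ∀ᶠ n in atTop, s n ≠ 0) (hX : Tendsto (fun n => s n * X n) atTop (𝓝 p))
    (hY : Tendsto (fun n => s n * Y n) atTop (𝓝 q)) :
    Tendsto (fun n => X n / (X n + Y n)) atTop (𝓝 (p / (p + q))) := by
  refine (hX.div (hX.add hY) hpq).congr' ?_
  filter_upwards [hs] with n hn
  rw [Pi.div_apply, ← mul_add, mul_div_mul_left _ _ hn]

end InhomIntersection

end

theorem theorem3
    (P₁ P₂ : Measure ℝ≥0) [IsProbabilityMeasure P₁] [IsProbabilityMeasure P₂]
    (hA : Integrable (fun x : ℝ≥0 => (x : ℝ) ^ 2) P₁) (hA_pos : 0 < InhomIntersection.mom P₁ 2)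
    (hB : Integrable (fun y : ℝ≥0 => (y : ℝ) ^ 3) P₂) (hB_pos : 0 < InhomIntersection.mom P₂ 3)
    (m : ℕ → ℕ) (β : ℝ) (hβ : 0 < β)
    (hm : Tendsto (fun n : ℕ => (m n : ℝ) / (n : ℝ)) atTop (𝓝 β)) :
    Tendsto (fun n : ℕ => InhomIntersection.clusteringCoeff P₁ P₂ n (m n)) atTop
      (𝓝 (InhomIntersection.mom P₂ 3 * InhomIntersection.kappa P₁ P₂ /
        (InhomIntersection.mom P₂ 3 * InhomIntersection.kappa P₁ P₂ + Real.sqrt β))) ∧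
    (fun n : ℕ => InhomIntersection.clusteringFun P₁ P₂ n (m n) 0) ~[atTop]
      (fun n : ℕ => InhomIntersection.mom P₁ 1 ^ 2 *
        InhomIntersection.momStar P₁ P₂ β 2 * (n : ℝ)⁻¹) ∧
    (fun n : ℕ => InhomIntersection.clusteringFun P₁ P₂ n (m n) 1) ~[atTop]
      (fun _ : ℕ => InhomIntersection.momStar P₁ P₂ β 3 * InhomIntersection.kappa P₁ P₂ /
        (InhomIntersection.momStar P₁ P₂ β 3 * InhomIntersection.kappa P₁ P₂ + Real.sqrt β)) ∧
    ∀ r : ℕ, 2 ≤ r →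
      Tendsto (fun n : ℕ => InhomIntersection.clusteringFun P₁ P₂ n (m n) r) atTop (𝓝 1) := by
  open InhomIntersection in
  have hs : 0 < Real.sqrt β := Real.sqrt_pos.2 hβ
  have hB2 := integrable_pow_of_le hB (show 2 ≤ 3 by norm_num)
  have ha1 : 0 < mom P₁ 1 :=
    mom_pos_of_mom_pos two_ne_zero (integrable_pow_of_le hA one_le_two) hA_pos
  have hb2 : 0 < mom P₂ 2 := mom_pos_of_mom_pos three_ne_zero hB2 hB_pos
  have hq : ∀ r, 0 < poissonMoment P₁ P₂ β r := poissonMoment_pos hβ ha1 hB2 hb2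
  have hk : 0 < kappa P₁ P₂ := by unfold kappa; positivity
  have hn : ∀ᶠ n : ℕ in atTop, (n : ℝ) ≠ 0 := by
    filter_upwards [eventually_gt_atTop 0] with n hn
    positivity
  have hN := tendsto_adjCodeg hA hB hβ hm
  simp only [clusteringFun_eq, clusteringCoeff_eq]
  refine ⟨?_, ?_, ?_, fun r hr => ?_⟩
  · rw [← kappa_ratio hs hB_pos ha1 hA_pos hb2]
    exact tendsto_ratio_of_scaled (by positivity) (hn.mono fun n h => pow_ne_zero 2 h)
      (tendsto_triangleProb hA hB hβ hm) (tendsto_openPathProb hA hB hβ hm)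
  · have h0 := hq 0
    rw [poissonMoment_zero] at h0
    have hN0 := hN 0
    rw [poissonMoment_zero] at hN0
    rw [isEquivalent_iff_tendsto_one (hn.mono fun n h => mul_ne_zero h0.ne' (inv_ne_zero h))]
    have h1 := (hN0.div (tendsto_codeg_zero hA hB hβ hm) one_ne_zero).div_const
      (mom P₁ 1 ^ 2 * momStar P₁ P₂ β 2)
    rw [div_one, div_self h0.ne'] at h1
    refine h1.congr' ?_
    filter_upwards [hn] with n hn
    simp only [Pi.div_apply]
    rw [mul_div_assoc]
    generalize mom P₁ 1 ^ 2 * momStar P₁ P₂ β 2 = c at h0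
    generalize adjCodeg P₁ P₂ n (m n) 0 / _ = X
    field_simp
  · have h1 := hq 1
    rw [poissonMoment_one, div_mul_eq_mul_div] at h1
    have hN1 := hN 1
    rw [poissonMoment_one, div_mul_eq_mul_div] at hN1
    -- Positivity is read off from `poissonMoment_pos` at `r = 1`, since the other factors are
    -- nonnegative.
    have hm3 : 0 < momStar P₁ P₂ β 3 := by
      by_contra hneg
      have := mul_nonpos_of_nonneg_of_nonpos (pow_nonneg ha1.le 3) (not_lt.1 hneg)
      exact absurd h1 (not_lt.2 (div_nonpos_of_nonpos_of_nonneg this hs.le))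
    refine (isEquivalent_const_iff_tendsto (ne_of_gt (by positivity))).2 ?_
    rw [← kappa_ratio hs hm3 ha1 hA_pos hb2]
    exact tendsto_ratio_of_scaled (by positivity) hn hN1 (tendsto_notAdjCodeg_one hA hB hβ hm)
  -- The adjacent part has order exactly `1/n` because `poissonMoment` is positive, while the
  -- non-adjacent part is `o(1/n)`.
  · have := tendsto_ratio_of_scaled (by simpa using (hq r).ne') hn (hN r)
      (tendsto_notAdjCodeg hA hB hβ hm hr)
    rwa [add_zero, div_self (hq r).ne'] at this
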